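/- Let $\mathcal H,\mathcal K$ be finite-dimensional complex Hilbert spaces and let $T:B(\mathcal H)\to B(\mathcal K)$ be a linear, trace-preserving, 2-positive map. Let $D_1,D_2$ be invertible density operators on $\mathcal H$ such that $T(D_1),T(D_2)$ are invertible. Assume that $T$ is sufficient for $D_1,D_2$, i.e. there is a trace-preserving 2-positive map $\beta:B(\mathcal K)\to B(\mathcal H)$ with $\beta(T(D_s))=D_s$ for $s=1,2$. Let $T^*$ be the adjoint of $T$ for the Hilbert--Schmidt inner products, let $$\alpha(A)=T(D_1)^{-1/2}\,T\big(D_1^{1/2}AD_1^{1/2}\big)\,T(D_1)^{-1/2}\qquad(A\in B(\mathcal H)),$$ and let $T^\#:B(\mathcal K)\to B(\mathcal H)$ be the Hilbert--Schmidt adjoint of $\alpha$. If $\mathcal M$ is a *-algebra of operators isomorphic to a full matrix algebra, a density operator of $\mathcal M$ means a positive $x\in\mathcal M$ that has trace one for the trace of $\mathcal M$ taking the value $1$ at minimal projections (that is, $\mathrm{Tr}\,x=\mathrm{Tr}\,e$ for every minimal projection $e$ of $\mathcal M$). A prime denotes the commutant. Then the fixed-point sets $\mathcal D_{\mathcal K}$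 of $\alpha\circ T^*$ and $\mathcal D_{\mathcal H}$ of $T^*\circ\alpha$ are unital *-subalgebras of $B(\mathcal K)$ and $B(\mathcal H)$, and $T^*(XY)=T^*(X)T^*(Y)$ for all $X\in B(\mathcal K)$, $Y\in\mathcal D_{\mathcal K}$. Let $z_1,\dots,z_r$ be the distinct minimal central projections of $\mathcal D_{\mathcal K}$. There are probability distributions $\lambda_s(p)$ ($1\le p\le r$, $s=1,2$), density operators $S_s(p)$ of $z_p\mathcal D_{\mathcal K}$, and density operators $R(p)$ of $z_p\mathcal D_{\mathcal K}'$, not depending on $s$, with $$T(D_s)=\sum_{p=1}^r\lambda_s(p)\,S_s(p)R(p)\qquad(s=1,2),$$ such that the following holds on $\mathcal H$. The operators $q_p=T^*(z_p)$ are the distinct minimal central projections of $\mathcal D_{\mathcal H}$, and they are pairwise orthogonal. There are density operators $S_s^{\mathcal H}(p)$ of $q_p\mathcal D_{\mathcal H}$ with $\alpha(S_s^{\mathcal H}(p))=S_s(p)$. The operators $R^{\mathcal H}(p)=T^\#(R(p))$ are density operators of $q_p\mathcal D_{\mathcal H}'$. For all $s,p$ the factors $S_s^{\mathcal H}(p)$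 and $R^{\mathcal H}(p)$ commute, and $$D_s=\sum_{p=1}^r\lambda_s(p)\,S_s^{\mathcal H}(p)\,R^{\mathcal H}(p)\qquad(s=1,2).$$ -/

import Mathlib

open scoped InnerProductSpace ComplexOrder

noncomputable section

namespace QCG

section Ops

variable {H : Type*} [NormedAddCommGroup H] [InnerProductSpace ℂ H]

/-- The trace of an operator. -/
def tr (A : H →L[ℂ] H) : ℂ := LinearMap.trace ℂ H (A : H →ₗ[ℂ] H)

/-- `BlockNonneg A B C D` says that the operator on `H ⊕ H` with block matrix
`[[A, B], [C, D]]` is positive: its quadratic form is nonnegative at every `(x, y)`. -/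
def BlockNonneg (A B C D : H →L[ℂ] H) : Prop :=
  ∀ x y : H, 0 ≤ ⟪x, A x⟫_ℂ + ⟪x, B y⟫_ℂ + ⟪y, C x⟫_ℂ + ⟪y, D y⟫_ℂ

/-- A density operator on `H`. -/
def IsDensity [CompleteSpace H] (A : H →L[ℂ] H) : Prop := 0 ≤ A ∧ tr A = 1

/-- `e` is a minimal (nonzero, self-adjoint) projection of the set `A` of operators. -/
def IsMinimalProjectionIn [CompleteSpace H] (A : Set (H →L[ℂ] H)) (e : H →L[ℂ] H) : Prop :=
  e ∈ A ∧ IsStarProjection e ∧ e ≠ 0 ∧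
    ∀ f ∈ A, IsStarProjection f → f ≤ e → f = 0 ∨ f = e

/-- `z` is a minimal central projection of `A`: a minimal projection of the center of `A`. -/
def IsMinimalCentralProjection [CompleteSpace H] (A : Set (H →L[ℂ] H)) (z : H →L[ℂ] H) : Prop :=
  IsMinimalProjectionIn (A ∩ Set.centralizer A) z

/-- The summand `z A`. -/
def corner (z : H →L[ℂ] H) (A : Set (H →L[ℂ] H)) : Set (H →L[ℂ] H) :=
  (fun a => z * a) '' A

/-- `x` is a density operator of `A`, where `A` is a *-algebra of operators isomorphic to a full
matrix algebra `M_n`. The isomorphism carries the usual trace of `M_n` to the multiple of `tr` that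
is `1` at the minimal projections of `A`; so `x` is normalized when `tr x = tr e` for these `e`. -/
def IsDensityIn [CompleteSpace H] (A : Set (H →L[ℂ] H)) (x : H →L[ℂ] H) : Prop :=
  x ∈ A ∧ 0 ≤ x ∧ ∀ e, IsMinimalProjectionIn A e → tr x = tr e

end Ops

section Maps

variable {H K : Type*} [NormedAddCommGroup H] [InnerProductSpace ℂ H]
  [NormedAddCommGroup K] [InnerProductSpace ℂ K]

def IsTracePreserving (T : (H →L[ℂ] H) →ₗ[ℂ] (K →L[ℂ] K)) : Prop :=
  ∀ A, tr (T A) = tr A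

def IsTwoPositive (T : (H →L[ℂ] H) →ₗ[ℂ] (K →L[ℂ] K)) : Prop :=
  ∀ A B C D, BlockNonneg A B C D → BlockNonneg (T A) (T B) (T C) (T D)

/-- `T` is sufficient for the family `D`: some trace-preserving 2-positive `β` recovers every
`D s` from `T (D s)`. -/
def IsSufficient {ι : Type*} (T : (H →L[ℂ] H) →ₗ[ℂ] (K →L[ℂ] K)) (D : ι → (H →L[ℂ] H)) : Prop :=
  ∃ β : (K →L[ℂ] K) →ₗ[ℂ] (H →L[ℂ] H),
    IsTracePreserving β ∧ IsTwoPositive β ∧ ∀ s, β (T (D s)) = D s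

variable [FiniteDimensional ℂ H] [CompleteSpace H] [CompleteSpace K]

/-- The matrix units `|e i⟩⟨e j|` of the standard orthonormal basis of `H`. -/
def matUnit (i j : Fin (Module.finrank ℂ H)) : H →L[ℂ] H :=
  InnerProductSpace.rankOne ℂ (stdOrthonormalBasis ℂ H i) (stdOrthonormalBasis ℂ H j)

/-- The adjoint `T*` of `T` for the Hilbert-Schmidt inner products `⟨A, B⟩ = tr (A* B)`, expanded
in the orthonormal basis of matrix units of `B(H)`; see `tr_star_mul_hsAdjoint`. -/
def hsAdjoint (T : (H →L[ℂ] H) →ₗ[ℂ] (K →L[ℂ] K)) : (K →L[ℂ] K) →ₗ[ℂ] (H →L[ℂ] H) where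
  toFun X := ∑ i, ∑ j, tr (star (T (matUnit i j)) * X) • matUnit i j
  map_add' X Y := by
    simp [tr, mul_add, add_smul, Finset.sum_add_distrib]
  map_smul' c X := by
    simp [tr, mul_smul, Finset.smul_sum]

theorem tr_star_mul_hsAdjoint (T : (H →L[ℂ] H) →ₗ[ℂ] (K →L[ℂ] K)) (A : H →L[ℂ] H)
    (X : K →L[ℂ] K) : tr (star A * hsAdjoint T X) = tr (star (T A) * X) := by
  have key : ∀ i j, tr (star A * matUnit i j) =
      star (⟪stdOrthonormalBasis ℂ H i, A (stdOrthonormalBasis ℂ H j)⟫_ℂ) := by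
    intro i j
    have h : star A * matUnit i j = InnerProductSpace.rankOne ℂ
        ((star A) (stdOrthonormalBasis ℂ H i)) (stdOrthonormalBasis ℂ H j) := by
      ext v
      simp [matUnit]
    rw [h]
    simp only [tr, InnerProductSpace.trace_rankOne]
    rw [ContinuousLinearMap.star_eq_adjoint, ContinuousLinearMap.adjoint_inner_right]
    exact (inner_conj_symm _ _).symm
  have hA : A = ∑ i, ∑ j,
      ⟪stdOrthonormalBasis ℂ H i, A (stdOrthonormalBasis ℂ H j)⟫_ℂ • matUnit i j := by
    ext v
    simp only [matUnit, sum_apply, smul_apply,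
      InnerProductSpace.rankOne_apply]
    rw [Finset.sum_comm]
    conv_lhs => rw [← (stdOrthonormalBasis ℂ H).sum_repr' v, map_sum]
    refine Finset.sum_congr rfl fun j _ => ?_
    rw [map_smul]
    conv_lhs => rw [← (stdOrthonormalBasis ℂ H).sum_repr' (A (stdOrthonormalBasis ℂ H j))]
    rw [Finset.smul_sum]
    exact Finset.sum_congr rfl fun i _ => smul_comm _ _ _
  have trsum : ∀ {ι : Type} (S : Finset ι) (f : ι → (H →L[ℂ] H)),
      tr (∑ i ∈ S, f i) = ∑ i ∈ S, tr (f i) := by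
    intro ι S f
    simp [tr]
  have trsum' : ∀ {ι : Type} (S : Finset ι) (f : ι → (K →L[ℂ] K)),
      tr (∑ i ∈ S, f i) = ∑ i ∈ S, tr (f i) := by
    intro ι S f
    simp [tr]
  have trsmul : ∀ (c : ℂ) (B : H →L[ℂ] H), tr (c • B) = c * tr B := by
    intro c B
    simp [tr]
  have trsmul' : ∀ (c : ℂ) (B : K →L[ℂ] K), tr (c • B) = c * tr B := by
    intro c B
    simp [tr]
  have hL : tr (star A * hsAdjoint T X) = ∑ i, ∑ j, tr (star (T (matUnit i j)) * X) *
      star (⟪stdOrthonormalBasis ℂ H i, A (stdOrthonormalBasis ℂ H j)⟫_ℂ) := by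
    have h : hsAdjoint T X = ∑ i, ∑ j, tr (star (T (matUnit i j)) * X) • matUnit i j := rfl
    rw [h]
    simp only [Finset.mul_sum, mul_smul_comm, trsum, trsmul, key]
  rw [hL]
  conv_rhs => rw [hA]
  simp only [map_sum, map_smul, star_sum, star_smul, Finset.sum_mul, smul_mul_assoc, trsum',
    trsmul']
  exact Finset.sum_congr rfl fun i _ => Finset.sum_congr rfl fun j _ => mul_comm _ _

/-- The dual `α` of `T*` for the inner products weighted by `D` and `T D`:
`α(A) = T(D)^{-1/2} T(D^{1/2} A D^{1/2}) T(D)^{-1/2}`. -/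
def alpha (T : (H →L[ℂ] H) →ₗ[ℂ] (K →L[ℂ] K)) (D : H →L[ℂ] H) :
    (H →L[ℂ] H) →ₗ[ℂ] (K →L[ℂ] K) where
  toFun A := (T D) ^ (-(1 / 2) : ℝ) * T (D ^ (1 / 2 : ℝ) * A * D ^ (1 / 2 : ℝ)) *
    (T D) ^ (-(1 / 2) : ℝ)
  map_add' A B := by simp [mul_add, add_mul]
  map_smul' c A := by simp

/-- The map `T^#`: the Hilbert-Schmidt adjoint of `α`. -/
def sharp (T : (H →L[ℂ] H) →ₗ[ℂ] (K →L[ℂ] K)) (D : H →L[ℂ] H) :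
    (K →L[ℂ] K) →ₗ[ℂ] (H →L[ℂ] H) :=
  hsAdjoint (alpha T D)

end Maps

end QCG

end

/-!
Write `ρ s = T (D s)`, `A = T*` and `α` for the maps of the statement. Both `A` and `α` are unital
Schwarz maps, and `A` pulls the weight `tr (D 0 ·)` back to `tr (ρ 0 ·)` while `α` does the
converse (`isStatePair_alpha`). Such a pair of maps, an `IsStatePair`, has a multiplicative theory:
at a fixed point of `α ∘ A` the Schwarz inequality for `A` is an equality, since both sides have the
same faithful weight, so the fixed points form a star algebra on which `A` is multiplicative, with
inverse `α`.

For the GNS inner product of `ρ 0` the map `α ∘ A` is a contraction, and a contraction fixes every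
vector fixed by its adjoint (`IsStatePair.mem_of_forall_tr`). This gives the invariance of the
fixed points under `Y ↦ ρ Y ρ⁻¹` and, if a second pair of weights is exchanged as well, the
membership of `ρ 1 (ρ 0)⁻¹` (`IsStatePair.modular_mem`, `IsStatePair.cocycle_mem`). If `σ` is the
density of the weight of `ρ` restricted to the fixed-point algebra, then `σ` and `ρ` induce the
same modular automorphism there, so that `ρ = σ R` with `R` in the commutant; correspondingly
`D = A(σ) R'` (`IsStatePair.exists_factorization`).

Sufficiency enters through the recovery map `β`: the pair `(A, β*)` exchanges the weights for both
`s`, so `ρ 1 (ρ 0)⁻¹` is fixed by `β* ∘ A`. Splitting the square roots of `ρ 0` and `D 0` along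
the fixed points of `β* ∘ A` shows that these points are fixed by `α ∘ A` too
(`alpha_hsAdjoint_of_mem`). Hence both `ρ s` factor through the fixed points of `α ∘ A` with the same `R`
(`exists_common_factorization`).

The remaining statements concern a simple summand `z F` of a star algebra `F`. The density of a
tracial functional on `F` is central, so traces on `z F` are proportional
(`IsMinimalCentralProjection.exists_eq_mul_tr`), and the traces of the minimal projections of
`z F` and of its commutant multiply to `tr z` (`IsMinimalCentralProjection.tr_mul_tr`). These two
facts determine all the normalizations, without choosing an isomorphism with a matrix algebra.
-/

set_option linter.unusedSectionVars false

namespace QCG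

/-! ### The trace pairing -/

section Trace

variable {H : Type*} [NormedAddCommGroup H] [InnerProductSpace ℂ H]

/-- The trace as a linear functional. -/
noncomputable def trₗ : (H →L[ℂ] H) →ₗ[ℂ] ℂ :=
  LinearMap.trace ℂ H ∘ₗ ContinuousLinearMap.coeLM ℂ

theorem tr_sub (A B : H →L[ℂ] H) : tr (A - B) = tr A - tr B := map_sub trₗ A B

theorem tr_neg (A : H →L[ℂ] H) : tr (-A) = -tr A := map_neg trₗ A

theorem tr_zero : tr (0 : H →L[ℂ] H) = 0 := map_zero trₗ

theorem tr_smul (c : ℂ) (A : H →L[ℂ] H) : tr (c • A) = c * tr A := map_smul trₗ c A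

theorem tr_sum {ι : Type*} (s : Finset ι) (f : ι → H →L[ℂ] H) :
    tr (∑ i ∈ s, f i) = ∑ i ∈ s, tr (f i) := map_sum trₗ f s

theorem tr_mul_comm (A B : H →L[ℂ] H) : tr (A * B) = tr (B * A) :=
  LinearMap.trace_mul_comm ℂ (A : H →ₗ[ℂ] H) (B : H →ₗ[ℂ] H)

/-- Cyclicity of the trace for three factors. -/
theorem tr_mul_cycle (A B C : H →L[ℂ] H) : tr (A * B * C) = tr (C * A * B) := by
  rw [tr_mul_comm, mul_assoc]

variable [FiniteDimensional ℂ H] [CompleteSpace H]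

theorem tr_eq_sum_inner {ι : Type*} [Fintype ι] (b : OrthonormalBasis ι ℂ H) (A : H →L[ℂ] H) :
    tr A = ∑ i, ⟪b i, A (b i)⟫_ℂ :=
  LinearMap.trace_eq_sum_inner (A : H →ₗ[ℂ] H) b

theorem tr_rankOne_mul (u v : H) (A : H →L[ℂ] H) :
    tr (InnerProductSpace.rankOne ℂ u v * A) = ⟪v, A u⟫_ℂ := by
  have : A * InnerProductSpace.rankOne ℂ u v = InnerProductSpace.rankOne ℂ (A u) v := by
    ext w
    simp
  rw [tr_mul_comm, this]
  exact InnerProductSpace.trace_rankOne _ _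

theorem tr_star (A : H →L[ℂ] H) : tr (star A) = star (tr A) := by
  rw [tr_eq_sum_inner (stdOrthonormalBasis ℂ H), tr_eq_sum_inner (stdOrthonormalBasis ℂ H),
    star_sum]
  refine Finset.sum_congr rfl fun i _ => ?_
  rw [ContinuousLinearMap.star_eq_adjoint, ContinuousLinearMap.adjoint_inner_right]
  exact (inner_conj_symm _ _).symm

theorem nonneg_iff_inner {A : H →L[ℂ] H} : 0 ≤ A ↔ ∀ x, 0 ≤ ⟪x, A x⟫_ℂ := by
  rw [ContinuousLinearMap.nonneg_iff_isPositive]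
  constructor
  · intro h x
    exact h.inner_nonneg_right x
  · intro h
    rw [ContinuousLinearMap.isPositive_iff_complex]
    intro x
    have h1 := h x
    have h2 : ⟪A x, x⟫_ℂ = ⟪x, A x⟫_ℂ := by
      rw [← inner_conj_symm]
      exact Complex.conj_eq_iff_im.2 (Complex.nonneg_iff.1 h1).2.symm
    rw [h2]
    exact ⟨(Complex.eq_re_of_ofReal_le h1).symm, (Complex.nonneg_iff.1 h1).1⟩

theorem tr_nonneg {A : H →L[ℂ] H} (hA : 0 ≤ A) : 0 ≤ tr A := by
  rw [tr_eq_sum_inner (stdOrthonormalBasis ℂ H)]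
  exact Finset.sum_nonneg fun i _ => nonneg_iff_inner.1 hA _

theorem eq_zero_of_tr_star_mul_self {A : H →L[ℂ] H} (h : tr (star A * A) = 0) : A = 0 := by
  set b := stdOrthonormalBasis ℂ H
  have key : ∀ i, ⟪b i, (star A * A) (b i)⟫_ℂ = ((‖A (b i)‖ ^ 2 : ℝ) : ℂ) := by
    intro i
    rw [show (star A * A) (b i) = (star A) (A (b i)) from rfl, ContinuousLinearMap.star_eq_adjoint,
      ContinuousLinearMap.adjoint_inner_right, inner_self_eq_norm_sq_to_K]
    simp
  rw [tr_eq_sum_inner b] at h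
  simp only [key] at h
  rw [← Complex.ofReal_sum, Complex.ofReal_eq_zero,
    Finset.sum_eq_zero_iff_of_nonneg (fun i _ => by positivity)] at h
  have h2 : ∀ i, A (b i) = 0 := fun i => by simpa using h i (Finset.mem_univ i)
  apply ContinuousLinearMap.coe_injective
  exact b.toBasis.ext fun i => by simpa using h2 i

/-- The trace pairing separates operators. -/
theorem eq_of_forall_tr_mul {A B : H →L[ℂ] H} (h : ∀ X, tr (X * A) = tr (X * B)) : A = B := by
  rw [← sub_eq_zero]
  apply eq_zero_of_tr_star_mul_self
  rw [mul_sub, tr_sub, h, sub_self]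

theorem tr_mul_nonneg {A B : H →L[ℂ] H} (hA : 0 ≤ A) (hB : 0 ≤ B) : 0 ≤ tr (A * B) := by
  obtain ⟨C, rfl⟩ := CStarAlgebra.nonneg_iff_eq_star_mul_self.1 hB
  rw [← mul_assoc, tr_mul_comm, ← mul_assoc]
  exact tr_nonneg (star_right_conjugate_nonneg hA C)

theorem tr_mul_mono {A B C : H →L[ℂ] H} (hA : 0 ≤ A) (h : B ≤ C) :
    tr (A * B) ≤ tr (A * C) := by
  have := tr_mul_nonneg hA (sub_nonneg.2 h)
  rwa [mul_sub, tr_sub, sub_nonneg] at this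

/-- An invertible positive operator is a faithful weight. -/
theorem eq_zero_of_tr_mul_eq_zero {D A : H →L[ℂ] H} (hD : IsStrictlyPositive D) (hA : 0 ≤ A)
    (h : tr (D * A) = 0) : A = 0 := by
  obtain ⟨C, rfl⟩ := CStarAlgebra.nonneg_iff_eq_mul_star_self.1 hA
  obtain ⟨E, hE, hDE⟩ := CStarAlgebra.isStrictlyPositive_iff_eq_star_mul_self.1 hD
  have h0 : E * C = 0 := by
    apply eq_zero_of_tr_star_mul_self
    have h1 : star (E * C) * (E * C) = star C * (star E * E) * C := by
      simp only [star_mul, mul_assoc]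
    rw [h1, tr_mul_cycle, tr_mul_comm, ← hDE, h]
  have h1 : C = 0 := hE.mul_right_eq_zero.1 h0
  simp [h1]

/-- A faithful weight compares positive operators: if `A ≤ B` and their weights are in the
reverse order, then `A = B`. -/
theorem eq_of_le_of_tr_mul_le {D A B : H →L[ℂ] H} (hD : IsStrictlyPositive D) (hAB : A ≤ B)
    (h : tr (D * B) ≤ tr (D * A)) : A = B := by
  have h1 := eq_zero_of_tr_mul_eq_zero hD (sub_nonneg.2 hAB) (by
    rw [mul_sub, tr_sub, sub_eq_zero]
    exact le_antisymm h (tr_mul_mono hD.nonneg hAB))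
  exact (sub_eq_zero.1 h1).symm

end Trace

/-! ### Unital maps satisfying the Schwarz inequality -/

section Block

variable {H : Type*} [NormedAddCommGroup H] [InnerProductSpace ℂ H] [FiniteDimensional ℂ H]
  [CompleteSpace H]

theorem inner_apply_eq_star (A : H →L[ℂ] H) (x y : H) :
    ⟪x, (star A) y⟫_ℂ = ⟪A x, y⟫_ℂ := by
  rw [ContinuousLinearMap.star_eq_adjoint, ContinuousLinearMap.adjoint_inner_right]

theorem op_mul_apply (A B : H →L[ℂ] H) (x : H) : (A * B) x = A (B x) := rfl

theorem blockNonneg_schwarz (X : H →L[ℂ] H) : BlockNonneg (star X * X) (star X) X 1 := by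
  intro x y
  have h : ⟪x, (star X * X) x⟫_ℂ + ⟪x, (star X) y⟫_ℂ + ⟪y, X x⟫_ℂ + ⟪y, (1 : H →L[ℂ] H) y⟫_ℂ
      = ⟪X x + y, X x + y⟫_ℂ := by
    rw [op_mul_apply, inner_apply_eq_star, inner_apply_eq_star,
      inner_add_left, inner_add_right, inner_add_right]
    simp only [one_apply_eq_self]
    ring
  rw [h, inner_self_eq_norm_sq_to_K]
  exact pow_nonneg (Complex.zero_le_real.2 (norm_nonneg (X x + y))) 2

theorem blockNonneg_rankOne (x y : H) :
    BlockNonneg (InnerProductSpace.rankOne ℂ x x) (InnerProductSpace.rankOne ℂ x y)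
      (InnerProductSpace.rankOne ℂ y x) (InnerProductSpace.rankOne ℂ y y) := by
  intro u v
  have h : ⟪u, InnerProductSpace.rankOne ℂ x x u⟫_ℂ + ⟪u, InnerProductSpace.rankOne ℂ x y v⟫_ℂ +
      ⟪v, InnerProductSpace.rankOne ℂ y x u⟫_ℂ + ⟪v, InnerProductSpace.rankOne ℂ y y v⟫_ℂ
      = star (⟪x, u⟫_ℂ + ⟪y, v⟫_ℂ) * (⟪x, u⟫_ℂ + ⟪y, v⟫_ℂ) := by
    simp only [InnerProductSpace.rankOne_apply, inner_smul_right, star_add]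
    rw [← inner_conj_symm u x, ← inner_conj_symm v y]
    simp only [starRingEnd_apply]
    ring
  rw [h]
  exact star_mul_self_nonneg _

theorem BlockNonneg.conj {P Q R S : H →L[ℂ] H} (h : BlockNonneg P Q R S) (C : H →L[ℂ] H) :
    BlockNonneg (star C * P * C) (star C * Q * C) (star C * R * C) (star C * S * C) := by
  intro x y
  simpa only [op_mul_apply, inner_apply_eq_star] using h (C x) (C y)

/-- A positive block operator is self-adjoint. -/
theorem BlockNonneg.eq_star {P Q R S : H →L[ℂ] H} (h : BlockNonneg P Q R S) : Q = star R := by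
  ext y
  refine ext_inner_left ℂ fun x => ?_
  rw [inner_apply_eq_star]
  have h1 := (Complex.nonneg_iff.1 (h x 0)).2
  have h2 := (Complex.nonneg_iff.1 (h 0 y)).2
  have h3 := (Complex.nonneg_iff.1 (h x y)).2
  have h4 := (Complex.nonneg_iff.1 (h x (Complex.I • y))).2
  have h5 := (Complex.nonneg_iff.1 (h 0 (Complex.I • y))).2
  have h6 : (⟪R x, y⟫_ℂ).re = (⟪y, R x⟫_ℂ).re := by rw [← inner_conj_symm, Complex.conj_re]
  have h7 : (⟪R x, y⟫_ℂ).im = -(⟪y, R x⟫_ℂ).im := by rw [← inner_conj_symm, Complex.conj_im]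
  simp at h1 h2 h3 h4 h5
  apply Complex.ext
  · linarith
  · linarith

theorem BlockNonneg.star_mul_self_le {P Q : H →L[ℂ] H} (h : BlockNonneg P (star Q) Q 1) :
    star Q * Q ≤ P := by
  rw [← sub_nonneg, nonneg_iff_inner]
  intro x
  have h1 := h x (-(Q x))
  have h2 : (star Q * Q) x = (star Q) (Q x) := rfl
  simp only [map_neg, inner_neg_right, inner_neg_left, inner_apply_eq_star,
    one_apply_eq_self] at h1
  rw [sub_apply, inner_sub_right, h2, inner_apply_eq_star]
  convert h1 using 1
  ring

end Block

section Schwarz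

variable {H K : Type*} [NormedAddCommGroup H] [InnerProductSpace ℂ H] [FiniteDimensional ℂ H]
  [CompleteSpace H] [NormedAddCommGroup K] [InnerProductSpace ℂ K] [FiniteDimensional ℂ K]
  [CompleteSpace K]

/-- A unital map satisfying the Schwarz inequality `A(X)* A(X) ≤ A(X* X)`, in the form of the
positivity of the block operators `[[A(X* X), A(X*)], [A(X), A(1)]]`. -/
structure IsSchwarz (A : (K →L[ℂ] K) →ₗ[ℂ] (H →L[ℂ] H)) : Prop where
  map_one : A 1 = 1
  block : ∀ X, BlockNonneg (A (star X * X)) (A (star X)) (A X) (A 1)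

namespace IsSchwarz

variable {A : (K →L[ℂ] K) →ₗ[ℂ] (H →L[ℂ] H)}

theorem map_star (hA : IsSchwarz A) (X : K →L[ℂ] K) : A (star X) = star (A X) :=
  (hA.block X).eq_star

theorem star_mul_le (hA : IsSchwarz A) (X : K →L[ℂ] K) :
    star (A X) * A X ≤ A (star X * X) := by
  have h := hA.block X
  rw [hA.map_star, hA.map_one] at h
  exact h.star_mul_self_le

theorem map_nonneg (hA : IsSchwarz A) {X : K →L[ℂ] K} (hX : 0 ≤ X) : 0 ≤ A X := by
  obtain ⟨C, rfl⟩ := CStarAlgebra.nonneg_iff_eq_star_mul_self.1 hX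
  exact (star_mul_self_nonneg _).trans (hA.star_mul_le C)

end IsSchwarz

/-- A real-affine function `c ↦ a + c b + c̄ b'` on `ℂ` that is bounded below is constant. -/
theorem eq_zero_of_forall_add_nonneg {a b b' : ℂ}
    (h : ∀ c : ℂ, 0 ≤ a + c * b + star c * b') : b = 0 := by
  have key : ∀ s : ℝ, (∀ t : ℝ, 0 ≤ a.re + t * s) → s = 0 := by
    intro s hs
    by_contra hne
    have := hs (-(a.re + 1) / s)
    rw [div_mul_cancel₀ _ hne] at this
    linarith
  have h0 := (Complex.nonneg_iff.1 (h 0)).2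
  have h1 := (Complex.nonneg_iff.1 (h 1)).2
  have h2 := (Complex.nonneg_iff.1 (h Complex.I)).2
  have h3 : b.re + b'.re = 0 := key _ fun t => by
    have := (Complex.nonneg_iff.1 (h t)).1
    simp at this
    linarith
  have h4 : -b.im + b'.im = 0 := key _ fun t => by
    have := (Complex.nonneg_iff.1 (h (t * Complex.I))).1
    simp at this
    linarith
  simp at h0 h1 h2
  apply Complex.ext
  · simp
    linarith
  · simp
    linarith

/-- The multiplicative domain: equality in the Schwarz inequality at `Y` makes the map
multiplicative against `Y`, because the defect `A(X* Z) - A(X)* A(Z)` is a positive form. -/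
theorem IsSchwarz.map_star_mul {A : (K →L[ℂ] K) →ₗ[ℂ] (H →L[ℂ] H)} (hA : IsSchwarz A)
    {Y : K →L[ℂ] K} (hY : A (star Y * Y) = star (A Y) * A Y) (X : K →L[ℂ] K) :
    A (star X * Y) = star (A X) * A Y := by
  rw [← sub_eq_zero]
  have hlin := inner_map_self_eq_zero
    ((A (star X * Y) - star (A X) * A Y : H →L[ℂ] H) : H →ₗ[ℂ] H)
  apply ContinuousLinearMap.coe_injective
  rw [ContinuousLinearMap.toLinearMap_zero]
  rw [← hlin]
  intro v
  rw [← inner_conj_symm, map_eq_zero]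
  refine eq_zero_of_forall_add_nonneg
    (a := ⟪v, (A (star X * X) - star (A X) * A X) v⟫_ℂ)
    (b' := ⟪v, (A (star Y * X) - star (A Y) * A X) v⟫_ℂ) fun c => ?_
  have h := nonneg_iff_inner.1 (sub_nonneg.2 (hA.star_mul_le (X + c • Y))) v
  have hop : A (star (X + c • Y) * (X + c • Y)) - star (A (X + c • Y)) * A (X + c • Y) =
      (A (star X * X) - star (A X) * A X) + c • (A (star X * Y) - star (A X) * A Y) +
        star c • (A (star Y * X) - star (A Y) * A X) := by
    simp only [map_add, map_smul, star_add, star_smul, add_mul, mul_add, smul_mul_assoc,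
      mul_smul_comm, hY, smul_sub, smul_add]
    abel
  rwa [hop, add_apply, add_apply, smul_apply, smul_apply, inner_add_right, inner_add_right,
    inner_smul_right, inner_smul_right] at h

end Schwarz

section FromTwoPositive

variable {H K : Type*} [NormedAddCommGroup H] [InnerProductSpace ℂ H] [FiniteDimensional ℂ H]
  [CompleteSpace H] [NormedAddCommGroup K] [InnerProductSpace ℂ K] [FiniteDimensional ℂ K]
  [CompleteSpace K] {T : (H →L[ℂ] H) →ₗ[ℂ] (K →L[ℂ] K)}

theorem IsTwoPositive.map_star (hT : IsTwoPositive T) (X : H →L[ℂ] H) :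
    T (star X) = star (T X) :=
  (hT _ _ _ _ (blockNonneg_schwarz X)).eq_star

theorem IsTwoPositive.map_nonneg (hT : IsTwoPositive T) {X : H →L[ℂ] H} (hX : 0 ≤ X) :
    0 ≤ T X := by
  rw [nonneg_iff_inner]
  intro x
  have h : BlockNonneg X 0 0 0 := fun x y => by simpa using nonneg_iff_inner.1 hX x
  simpa using hT _ _ _ _ h x 0

theorem tr_mul_hsAdjoint (hT : ∀ X, T (star X) = star (T X)) (A : H →L[ℂ] H) (X : K →L[ℂ] K) :
    tr (A * hsAdjoint T X) = tr (T A * X) := by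
  have h := tr_star_mul_hsAdjoint T (star A) X
  rwa [hT, star_star, star_star] at h

theorem inner_hsAdjoint (hT : IsTwoPositive T) (x y : H) (X : K →L[ℂ] K) :
    ⟪x, hsAdjoint T X y⟫_ℂ = tr (T (InnerProductSpace.rankOne ℂ y x) * X) := by
  rw [← tr_rankOne_mul, tr_mul_hsAdjoint hT.map_star]

/-- The Hilbert-Schmidt adjoint of a trace-preserving 2-positive map is a unital Schwarz map:
pairing with the positive block of the `|x⟩⟨y|` turns the claim into a sum of values of the
quadratic form of the image of that block. -/
theorem isSchwarz_hsAdjoint (hT : IsTwoPositive T) (htr : IsTracePreserving T) :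
    IsSchwarz (hsAdjoint T) where
  map_one := eq_of_forall_tr_mul fun X => by rw [tr_mul_hsAdjoint hT.map_star, mul_one, mul_one, htr]
  block X x y := by
    set b := stdOrthonormalBasis ℂ K
    have hpos := Finset.sum_nonneg fun i (_ : i ∈ Finset.univ) =>
      hT _ _ _ _ (blockNonneg_rankOne x y) ((star X) (b i)) (b i)
    convert hpos using 1
    simp only [inner_hsAdjoint hT, Finset.sum_add_distrib]
    have h1 : ∀ P : K →L[ℂ] K, ∑ i, ⟪(star X) (b i), P (b i)⟫_ℂ = tr (P * X) := by
      intro P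
      rw [tr_mul_comm, tr_eq_sum_inner b]
      refine Finset.sum_congr rfl fun i _ => ?_
      rw [← inner_apply_eq_star, star_star]
      rfl
    have h2 : ∀ P : K →L[ℂ] K, ∑ i, ⟪b i, P (b i)⟫_ℂ = tr P :=
      fun P => (tr_eq_sum_inner b P).symm
    have h3 := h1 (T (InnerProductSpace.rankOne ℂ x x) * star X)
    have h4 := h2 (T (InnerProductSpace.rankOne ℂ y x) * star X)
    simp only [op_mul_apply] at h3 h4
    rw [h3, h4, h1, h2, mul_assoc, mul_one]
    ring

theorem rpow_half_mul_self {D : H →L[ℂ] H} (hD : 0 ≤ D) :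
    D ^ (1 / 2 : ℝ) * D ^ (1 / 2 : ℝ) = D := by
  rw [← CFC.sqrt_eq_rpow]
  exact CFC.sqrt_mul_sqrt_self D hD

theorem star_rpow (D : H →L[ℂ] H) (t : ℝ) : star (D ^ t) = D ^ t :=
  (IsSelfAdjoint.of_nonneg CFC.rpow_nonneg).star_eq

theorem alpha_apply (T : (H →L[ℂ] H) →ₗ[ℂ] (K →L[ℂ] K)) (D A : H →L[ℂ] H) :
    alpha T D A = (T D) ^ (-(1 / 2) : ℝ) * T (D ^ (1 / 2 : ℝ) * A * D ^ (1 / 2 : ℝ)) *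
      (T D) ^ (-(1 / 2) : ℝ) := rfl

theorem isSchwarz_alpha (hT : IsTwoPositive T) {D : H →L[ℂ] H} (hD : 0 ≤ D)
    (hTD : IsStrictlyPositive (T D)) : IsSchwarz (alpha T D) where
  map_one := by
    rw [alpha_apply, mul_one, rpow_half_mul_self hD]
    exact CFC.conjugate_rpow_neg_one_half (T D)
  block X := by
    have h1 := (blockNonneg_schwarz X).conj (D ^ (1 / 2 : ℝ))
    have h2 := (hT _ _ _ _ h1).conj ((T D) ^ (-(1 / 2) : ℝ))
    simp only [star_rpow] at h2
    exact h2

/-- `α` transports the weight of `T D` to the weight of `D`. -/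
theorem tr_mul_alpha (htr : IsTracePreserving T) {D : H →L[ℂ] H} (hD : 0 ≤ D)
    (hTD : IsStrictlyPositive (T D)) (A : H →L[ℂ] H) :
    tr (T D * alpha T D A) = tr (D * A) := by
  have h1 : (T D) ^ (-(1 / 2) : ℝ) * T D * (T D) ^ (-(1 / 2) : ℝ) = 1 :=
    CFC.conjugate_rpow_neg_one_half (T D)
  rw [alpha_apply, ← mul_assoc, ← mul_assoc, tr_mul_cycle, ← mul_assoc, h1, one_mul, htr,
    tr_mul_cycle, rpow_half_mul_self hD]

end FromTwoPositive

/-! ### Pairs of Schwarz maps exchanging two faithful states -/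

section Pair

variable {H K : Type*} [NormedAddCommGroup H] [InnerProductSpace ℂ H] [FiniteDimensional ℂ H]
  [CompleteSpace H] [NormedAddCommGroup K] [InnerProductSpace ℂ K] [FiniteDimensional ℂ K]
  [CompleteSpace K]

/-- Unital Schwarz maps `A : B(K) → B(H)` and `B : B(H) → B(K)`, each pulling back
the faithful weight of its target, `tr (D ·)` respectively `tr (ρ ·)`, to that of its source. The composite
`B ∘ A` then preserves a faithful weight, and `A` and `B` are mutually inverse between the fixed
points of `B ∘ A` and those of `A ∘ B`. -/
structure IsStatePair (A : (K →L[ℂ] K) →ₗ[ℂ] (H →L[ℂ] H)) (B : (H →L[ℂ] H) →ₗ[ℂ] (K →L[ℂ] K))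
    (ρ : K →L[ℂ] K) (D : H →L[ℂ] H) : Prop where
  left : IsSchwarz A
  right : IsSchwarz B
  tr_left : ∀ X, tr (D * A X) = tr (ρ * X)
  tr_right : ∀ Z, tr (ρ * B Z) = tr (D * Z)
  posK : IsStrictlyPositive ρ
  posH : IsStrictlyPositive D

namespace IsStatePair

variable {A : (K →L[ℂ] K) →ₗ[ℂ] (H →L[ℂ] H)} {B : (H →L[ℂ] H) →ₗ[ℂ] (K →L[ℂ] K)}
  {ρ : K →L[ℂ] K} {D : H →L[ℂ] H}

theorem symm (h : IsStatePair A B ρ D) : IsStatePair B A D ρ :=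
  ⟨h.right, h.left, h.tr_right, h.tr_left, h.posH, h.posK⟩

theorem tr_comp (h : IsStatePair A B ρ D) (X : K →L[ℂ] K) : tr (ρ * B (A X)) = tr (ρ * X) := by
  rw [h.tr_right, h.tr_left]

theorem fixed_star (h : IsStatePair A B ρ D) {Y : K →L[ℂ] K} (hY : B (A Y) = Y) :
    B (A (star Y)) = star Y := by
  rw [h.left.map_star, h.right.map_star, hY]

/-- The Schwarz inequality is an equality at a fixed point, because both sides have the same
weight. -/
theorem map_star_mul_self (h : IsStatePair A B ρ D) {Y : K →L[ℂ] K} (hY : B (A Y) = Y) :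
    A (star Y * Y) = star (A Y) * A Y := by
  refine (eq_of_le_of_tr_mul_le h.posH (h.left.star_mul_le Y) ?_).symm
  rw [h.tr_left, ← h.tr_right]
  have := h.right.star_mul_le (A Y)
  rw [hY] at this
  exact tr_mul_mono h.posK.nonneg this

theorem map_mul_right (h : IsStatePair A B ρ D) {Y : K →L[ℂ] K} (hY : B (A Y) = Y)
    (X : K →L[ℂ] K) : A (X * Y) = A X * A Y := by
  have := h.left.map_star_mul (h.map_star_mul_self hY) (star X)
  rwa [← h.left.map_star, star_star] at this

theorem map_mul_left (h : IsStatePair A B ρ D) {Y : K →L[ℂ] K} (hY : B (A Y) = Y)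
    (X : K →L[ℂ] K) : A (Y * X) = A Y * A X := by
  have := congrArg star (h.map_mul_right (h.fixed_star hY) (star X))
  rwa [star_mul, ← h.left.map_star, ← h.left.map_star, ← h.left.map_star, star_mul, star_star,
    star_star] at this

/-- The fixed points of `B ∘ A`. -/
def fixedPoints (h : IsStatePair A B ρ D) : StarSubalgebra ℂ (K →L[ℂ] K) where
  carrier := {Y | B (A Y) = Y}
  mul_mem' {X Y} hX hY := by
    have hX' : B (A X) = X := hX
    have hY' : B (A Y) = Y := hY
    show B (A (X * Y)) = X * Y
    rw [h.map_mul_right hY', h.symm.map_mul_right (congrArg A hY'), hX', hY']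
  add_mem' {X Y} hX hY := by
    have hX' : B (A X) = X := hX
    have hY' : B (A Y) = Y := hY
    show B (A (X + Y)) = X + Y
    rw [map_add, map_add, hX', hY']
  algebraMap_mem' c := by
    show B (A (algebraMap ℂ _ c)) = algebraMap ℂ _ c
    rw [Algebra.algebraMap_eq_smul_one, map_smul, map_smul, h.left.map_one, h.right.map_one]
  star_mem' hX := h.fixed_star hX

theorem mem_fixedPoints (h : IsStatePair A B ρ D) {Y : K →L[ℂ] K} :
    Y ∈ h.fixedPoints ↔ B (A Y) = Y := Iff.rfl

theorem map_mem (h : IsStatePair A B ρ D) {Y : K →L[ℂ] K} (hY : Y ∈ h.fixedPoints) :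
    A Y ∈ h.symm.fixedPoints :=
  congrArg A hY

/-- A contraction fixes a vector as soon as its adjoint does: this is applied to `B ∘ A` on the
Hilbert space `B(K)` with inner product `tr (ρ X* Y)`. -/
theorem mem_of_forall_tr (h : IsStatePair A B ρ D) {d : K →L[ℂ] K}
    (hd : ∀ X, tr (ρ * (B (A X) * d)) = tr (ρ * (X * d))) : d ∈ h.fixedPoints := by
  set V := B (A d) with hV
  have e1 : tr (ρ * (star V * d)) = tr (ρ * (star d * d)) := by
    rw [hV, ← h.right.map_star, ← h.left.map_star, hd]
  have hρ : star ρ = ρ := (IsSelfAdjoint.of_nonneg h.posK.nonneg).star_eq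
  have sw : ∀ X Y : K →L[ℂ] K, tr (ρ * (star X * Y)) = star (tr (ρ * (star Y * X))) := by
    intro X Y
    rw [← tr_star, star_mul, star_mul, star_star, hρ, tr_mul_comm]
  have e2 : tr (ρ * (star d * V)) = tr (ρ * (star d * d)) := by
    rw [sw, e1, ← sw]
  have e3 : tr (ρ * (star V * V)) ≤ tr (ρ * (star d * d)) := by
    refine (tr_mul_mono h.posK.nonneg (h.right.star_mul_le (A d))).trans ?_
    rw [h.tr_right, ← h.tr_left]
    exact tr_mul_mono h.posH.nonneg (h.left.star_mul_le d)
  have e4 : tr (ρ * (star (V - d) * (V - d))) ≤ 0 := by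
    simp only [star_sub, sub_mul, mul_sub, tr_sub]
    rw [e1, e2, sub_self, sub_zero]
    exact sub_nonpos.2 e3
  have e5 := eq_zero_of_tr_mul_eq_zero h.posK (star_mul_self_nonneg (V - d))
    (le_antisymm e4 (tr_mul_nonneg h.posK.nonneg (star_mul_self_nonneg _)))
  exact sub_eq_zero.1 ((CStarRing.star_mul_self_eq_zero_iff _).1 e5)

/-- The fixed points are invariant under the modular automorphism `Y ↦ ρ Y ρ⁻¹`. -/
theorem modular_mem (h : IsStatePair A B ρ D) {Y Y' : K →L[ℂ] K} (hY : Y ∈ h.fixedPoints)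
    (hYY' : ρ * Y = Y' * ρ) : Y' ∈ h.fixedPoints := by
  have e : ∀ X, tr (ρ * (X * Y')) = tr (ρ * (Y * X)) := by
    intro X
    rw [← mul_assoc, tr_mul_cycle, ← hYY', mul_assoc]
  refine h.mem_of_forall_tr fun X => ?_
  rw [e, e, ← h.tr_comp (Y * X), h.map_mul_left hY, h.symm.map_mul_left (h.map_mem hY), hY]

/-- On the fixed points `A` intertwines the modular automorphisms of `ρ` and `D`. -/
theorem modular_map (h : IsStatePair A B ρ D) {Y Y' : K →L[ℂ] K} (hY : Y ∈ h.fixedPoints)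
    (hYY' : ρ * Y = Y' * ρ) : D * A Y = A Y' * D := by
  have hY' := h.modular_mem hY hYY'
  have e : ∀ X, tr (ρ * (X * Y')) = tr (ρ * (Y * X)) := by
    intro X
    rw [← mul_assoc, tr_mul_cycle, ← hYY', mul_assoc]
  refine eq_of_forall_tr_mul fun Z => ?_
  have e1 : tr (Z * (D * A Y)) = tr (D * (A Y * Z)) := by rw [tr_mul_comm, mul_assoc]
  have e2 : tr (Z * (A Y' * D)) = tr (D * (Z * A Y')) := by
    rw [← mul_assoc, tr_mul_comm]
  rw [e1, e2, ← h.tr_right, ← h.tr_right, h.symm.map_mul_left (h.map_mem hY),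
    h.symm.map_mul_right (h.map_mem hY'), hY, hY', e]

/-- If the pair also exchanges the weights of `d ρ` and `D₂`, then `d` is a fixed point and
`D₂ = A(d) D`. -/
theorem cocycle_mem (h : IsStatePair A B ρ D) {d : K →L[ℂ] K} {D₂ : H →L[ℂ] H}
    (hl : ∀ X, tr (D₂ * A X) = tr (d * ρ * X)) (hr : ∀ Z, tr (d * ρ * B Z) = tr (D₂ * Z)) :
    d ∈ h.fixedPoints ∧ D₂ = A d * D := by
  have e : ∀ X, tr (ρ * (X * d)) = tr (d * ρ * X) := by
    intro X
    rw [← mul_assoc, tr_mul_comm, ← mul_assoc]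
  have hd : d ∈ h.fixedPoints := h.mem_of_forall_tr fun X => by rw [e, e, hr, hl]
  refine ⟨hd, eq_of_forall_tr_mul fun Z => ?_⟩
  rw [tr_mul_comm, ← hr, ← e, ← mul_assoc Z, tr_mul_comm _ D, ← h.tr_right,
    h.symm.map_mul_right (h.map_mem hd), hd]

end IsStatePair

end Pair

/-! ### Densities with respect to a star subalgebra -/

section Density

variable {K : Type*} [NormedAddCommGroup K] [InnerProductSpace ℂ K] [FiniteDimensional ℂ K]
  [CompleteSpace K]

theorem isClosed_starSubalgebra (F : StarSubalgebra ℂ (K →L[ℂ] K)) :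
    IsClosed (F : Set (K →L[ℂ] K)) :=
  (Subalgebra.toSubmodule F.toSubalgebra).closed_of_finiteDimensional

/-- The trace pairing is nondegenerate on a star subalgebra, so every functional is given on it by
a density in the subalgebra. -/
theorem exists_mem_tr_mul (F : StarSubalgebra ℂ (K →L[ℂ] K)) (τ : (K →L[ℂ] K) →ₗ[ℂ] ℂ) :
    ∃ w ∈ F, ∀ x ∈ F, τ x = tr (w * x) := by
  set V : Submodule ℂ (K →L[ℂ] K) := Subalgebra.toSubmodule F.toSubalgebra
  let Ψ : V →ₗ[ℂ] Module.Dual ℂ V :=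
    { toFun := fun w => (trₗ ∘ₗ LinearMap.mulLeft ℂ (w : K →L[ℂ] K)) ∘ₗ V.subtype
      map_add' := fun a b => by
        ext x
        simp [add_mul]
      map_smul' := fun c a => by
        ext x
        simp }
  have hΨ : ∀ w x : V, Ψ w x = tr ((w : K →L[ℂ] K) * (x : K →L[ℂ] K)) := fun _ _ => rfl
  have hinj : Function.Injective Ψ := by
    rw [injective_iff_map_eq_zero]
    intro w hw
    have h1 := hΨ w ⟨star (w : K →L[ℂ] K), star_mem (S := StarSubalgebra ℂ (K →L[ℂ] K)) w.2⟩
    rw [hw] at h1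
    have h2 : star (w : K →L[ℂ] K) = 0 := eq_zero_of_tr_star_mul_self (by
      rw [star_star]
      exact h1.symm)
    exact Subtype.ext (star_eq_zero.1 h2)
  have hsurj : Function.Surjective Ψ :=
    (LinearMap.injective_iff_surjective_of_finrank_eq_finrank
      (Subspace.dual_finrank_eq (K := ℂ) (V := V)).symm).1 hinj
  obtain ⟨w, hw⟩ := hsurj (τ ∘ₗ V.subtype)
  refine ⟨w, w.2, fun x hx => ?_⟩
  rw [← hΨ w ⟨x, hx⟩, hw]
  rfl

/-- Elements of a star subalgebra are separated by the trace pairing with that subalgebra. -/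
theorem eq_of_mem_of_forall_tr_mul {F : StarSubalgebra ℂ (K →L[ℂ] K)} {a b : K →L[ℂ] K}
    (ha : a ∈ F) (hb : b ∈ F) (h : ∀ x ∈ F, tr (x * a) = tr (x * b)) : a = b := by
  rw [← sub_eq_zero]
  apply eq_zero_of_tr_star_mul_self
  rw [mul_sub, tr_sub, h _ (star_mem (sub_mem ha hb)), sub_self]

theorem nonneg_of_forall_tr_mul_nonneg {F : StarSubalgebra ℂ (K →L[ℂ] K)} {X : K →L[ℂ] K}
    (hX : X ∈ F) (hsa : IsSelfAdjoint X) (h : ∀ Y ∈ F, 0 ≤ Y → 0 ≤ tr (X * Y)) : 0 ≤ X := by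
  rw [CStarAlgebra.nonneg_iff_isSelfAdjoint_and_negPart_eq_zero]
  refine ⟨hsa, ?_⟩
  have hcl := isClosed_starSubalgebra F
  have hmem : X⁻ ∈ F := by
    rw [CFC.negPart_def]
    exact cfcₙ_mem _ hX
  have hn : (0 : K →L[ℂ] K) ≤ X⁻ := CFC.negPart_nonneg X
  have h1 : X * X⁻ = -(star X⁻ * X⁻) := by
    have h2 : X * X⁻ = (X⁺ - X⁻) * X⁻ := by rw [CFC.posPart_sub_negPart X hsa]
    rw [h2, sub_mul, CFC.posPart_mul_negPart, zero_sub, (IsSelfAdjoint.of_nonneg hn).star_eq]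
  have h2 := h _ hmem hn
  rw [h1, tr_neg, neg_nonneg] at h2
  exact eq_zero_of_tr_star_mul_self (le_antisymm h2 (tr_nonneg (star_mul_self_nonneg _)))

/-- The restriction of a faithful weight to a star subalgebra has a strictly positive density. -/
theorem exists_density (F : StarSubalgebra ℂ (K →L[ℂ] K)) {ρ : K →L[ℂ] K}
    (hρ : IsStrictlyPositive ρ) :
    ∃ σ ∈ F, IsStrictlyPositive σ ∧ ∀ x ∈ F, tr (ρ * x) = tr (σ * x) := by
  obtain ⟨σ, hσF, hσ⟩ := exists_mem_tr_mul F (trₗ ∘ₗ LinearMap.mulLeft ℂ ρ)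
  replace hσ : ∀ x ∈ F, tr (ρ * x) = tr (σ * x) := hσ
  have hρs : star ρ = ρ := (IsSelfAdjoint.of_nonneg hρ.nonneg).star_eq
  have hsa : star σ = σ := by
    refine eq_of_mem_of_forall_tr_mul (star_mem hσF) hσF fun x hx => ?_
    rw [← star_star x, ← star_mul, tr_star, ← hσ _ (star_mem hx), ← tr_star, star_mul, star_star,
      hρs, tr_mul_comm, hσ _ hx, tr_mul_comm]
  rcases subsingleton_or_nontrivial (K →L[ℂ] K) with _ | _
  · exact ⟨ρ, Subsingleton.elim σ ρ ▸ hσF, hρ, fun _ _ => rfl⟩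
  -- A lower bound `r ≤ ρ` by a positive scalar passes to `σ`, which makes `σ` invertible.
  obtain ⟨r, hr, hle⟩ := (CFC.exists_pos_algebraMap_le_iff hρ.isSelfAdjoint).2
    (CStarAlgebra.isStrictlyPositive_iff_isSelfAdjoint_and_spectrum_pos.1 hρ).2
  have hle' : algebraMap ℝ (K →L[ℂ] K) r ≤ σ := by
    have hmem : algebraMap ℝ (K →L[ℂ] K) r ∈ F := by
      rw [IsScalarTower.algebraMap_apply ℝ ℂ (K →L[ℂ] K)]
      exact algebraMap_mem F _
    rw [← sub_nonneg]
    refine nonneg_of_forall_tr_mul_nonneg (sub_mem hσF hmem)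
      (IsSelfAdjoint.sub hsa (IsSelfAdjoint.algebraMap _ (IsSelfAdjoint.all r)))
      fun Y hY hY0 => ?_
    rw [sub_mul, tr_sub, ← hσ Y hY, ← tr_sub, ← sub_mul]
    exact tr_mul_nonneg (sub_nonneg.2 hle) hY0
  exact ⟨σ, hσF, CStarAlgebra.isStrictlyPositive_iff_isSelfAdjoint_and_spectrum_pos.2
    ⟨hsa, (CFC.exists_pos_algebraMap_le_iff hsa).1 ⟨r, hr, hle'⟩⟩, hσ⟩

theorem isStrictlyPositive_of_mul_eq {σ ρ R : K →L[ℂ] K} (hσ : IsStrictlyPositive σ)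
    (hρ : IsStrictlyPositive ρ) (h : ρ = σ * R) (hc : Commute σ R) : IsStrictlyPositive R := by
  obtain ⟨u, rfl⟩ := hσ.isUnit
  have hR : R = ↑u⁻¹ * ρ := by rw [h, Units.inv_mul_cancel_left]
  have hcρ : Commute (u : K →L[ℂ] K) ρ := by
    rw [h]
    exact (Commute.refl _).mul_right hc
  refine ⟨?_, ?_⟩
  · rw [hR]
    refine Commute.mul_nonneg ?_ hρ.nonneg hcρ.units_inv_left
    have h2 := hσ.ringInverse.nonneg
    rwa [Ring.inverse_unit] at h2
  · rw [hR]
    exact u⁻¹.isUnit.mul hρ.isUnit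

/-- If `σ` and `ρ = σ R` implement the same automorphism at `Y`, then `R` commutes with `Y`. -/
theorem commute_of_mul_eq {σ ρ R Y Y' : K →L[ℂ] K} (hσ : IsUnit σ) (h : ρ = σ * R)
    (h1 : ρ * Y = Y' * ρ) (h2 : σ * Y = Y' * σ) : Commute R Y := by
  apply hσ.mul_left_cancel
  rw [← mul_assoc, ← h, h1, h, ← mul_assoc, ← h2, mul_assoc]

end Density

section Factorization

variable {H K : Type*} [NormedAddCommGroup H] [InnerProductSpace ℂ H] [FiniteDimensional ℂ H]
  [CompleteSpace H] [NormedAddCommGroup K] [InnerProductSpace ℂ K] [FiniteDimensional ℂ K]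
  [CompleteSpace K]
  {A : (K →L[ℂ] K) →ₗ[ℂ] (H →L[ℂ] H)} {B : (H →L[ℂ] H) →ₗ[ℂ] (K →L[ℂ] K)}
  {ρ : K →L[ℂ] K} {D : H →L[ℂ] H}

theorem IsStatePair.map_isUnit (h : IsStatePair A B ρ D) {σ : K →L[ℂ] K}
    (hσF : σ ∈ h.fixedPoints) (hσ : IsUnit σ) : IsUnit (A σ) := by
  obtain ⟨u, rfl⟩ := hσ
  refine ⟨⟨A u, A ↑u⁻¹, ?_, ?_⟩, rfl⟩
  · rw [← h.map_mul_left hσF, Units.mul_inv, h.left.map_one]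
  · rw [← h.map_mul_right hσF, Units.inv_mul, h.left.map_one]

/-- The densities of a state pair split along the fixed-point algebra: `ρ = σ R` and
`D = A(σ) R'` with `σ` a fixed point, and `R`, `R'` commuting with the fixed points on their
side. Here `σ` is the density of the restricted weight; it induces on the fixed points the same
modular automorphism as `ρ`, so `σ⁻¹ ρ` commutes with them. -/
theorem IsStatePair.exists_factorization (h : IsStatePair A B ρ D) :
    ∃ (σ R : K →L[ℂ] K) (R' : H →L[ℂ] H), σ ∈ h.fixedPoints ∧ IsStrictlyPositive σ ∧
      IsStrictlyPositive R ∧ IsStrictlyPositive R' ∧ IsStrictlyPositive (A σ) ∧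
      ρ = σ * R ∧ D = A σ * R' ∧ (∀ Y ∈ h.fixedPoints, Commute R Y) ∧
      ∀ Y ∈ h.fixedPoints, Commute R' (A Y) := by
  obtain ⟨σ, hσF, hσ, htr⟩ := exists_density h.fixedPoints h.posK
  have hAσ : IsStrictlyPositive (A σ) :=
    ⟨h.left.map_nonneg hσ.nonneg, h.map_isUnit hσF hσ.isUnit⟩
  have hmod : ∀ Y ∈ h.fixedPoints, ∃ Y' ∈ h.fixedPoints, ρ * Y = Y' * ρ ∧ σ * Y = Y' * σ := by
    intro Y hY
    obtain ⟨Y', e⟩ : ∃ Y', ρ * Y = Y' * ρ := by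
      obtain ⟨u, hu⟩ := h.posK.isUnit
      refine ⟨ρ * Y * ↑u⁻¹, ?_⟩
      rw [← hu, mul_assoc _ _ (u : K →L[ℂ] K), Units.inv_mul, mul_one]
    have hY' := h.modular_mem hY e
    refine ⟨Y', hY', e, ?_⟩
    refine eq_of_mem_of_forall_tr_mul (mul_mem hσF hY) (mul_mem hY' hσF) fun x hx => ?_
    have e1 : tr (x * (σ * Y)) = tr (σ * (Y * x)) := by rw [tr_mul_comm, mul_assoc]
    have e2 : ∀ Z : K →L[ℂ] K, tr (x * (Y' * Z)) = tr (Z * (x * Y')) := by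
      intro Z
      rw [← mul_assoc, tr_mul_comm]
    rw [e1, e2, ← htr _ (mul_mem hY hx), ← htr _ (mul_mem hx hY'), ← e2, ← e, tr_mul_comm x,
      mul_assoc]
  have hR : ρ = σ * (Ring.inverse σ * ρ) := by
    rw [← mul_assoc, Ring.mul_inverse_cancel _ hσ.isUnit, one_mul]
  have hR' : D = A σ * (Ring.inverse (A σ) * D) := by
    rw [← mul_assoc, Ring.mul_inverse_cancel _ hAσ.isUnit, one_mul]
  have hc : ∀ Y ∈ h.fixedPoints, Commute (Ring.inverse σ * ρ) Y := by
    intro Y hY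
    obtain ⟨Y', hY', e1, e2⟩ := hmod Y hY
    exact commute_of_mul_eq hσ.isUnit hR e1 e2
  have hc' : ∀ Y ∈ h.fixedPoints, Commute (Ring.inverse (A σ) * D) (A Y) := by
    intro Y hY
    obtain ⟨Y', hY', e1, e2⟩ := hmod Y hY
    refine commute_of_mul_eq hAσ.isUnit hR' (h.modular_map hY e1) ?_
    rw [← h.map_mul_right hY, ← h.map_mul_right hσF, e2]
  exact ⟨σ, _, _, hσF, hσ, isStrictlyPositive_of_mul_eq hσ h.posK hR (hc σ hσF).symm,
    isStrictlyPositive_of_mul_eq hAσ h.posH hR' (hc' σ hσF).symm, hAσ, hR, hR', hc, hc'⟩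

end Factorization

/-! ### Sufficiency and the fixed points of `α ∘ T*` -/

section Petz

variable {H K : Type*} [NormedAddCommGroup H] [InnerProductSpace ℂ H] [FiniteDimensional ℂ H]
  [CompleteSpace H] [NormedAddCommGroup K] [InnerProductSpace ℂ K] [FiniteDimensional ℂ K]
  [CompleteSpace K]

theorem sqrt_mem (F : StarSubalgebra ℂ (K →L[ℂ] K)) {a : K →L[ℂ] K} (ha : 0 ≤ a) (haF : a ∈ F) :
    CFC.sqrt a ∈ F := by
  have := isClosed_starSubalgebra F
  rw [CFC.sqrt_eq_real_sqrt a ha]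
  exact cfcₙ_mem _ haF

theorem commute_sqrt {a b : K →L[ℂ] K} (h : Commute a b) : Commute (CFC.sqrt a) b :=
  h.cfcₙ_nnreal _

/-- The square root of a product of commuting positive operators. -/
theorem rpow_half_mul {a b s : K →L[ℂ] K} (hs : 0 ≤ s) (hsa : s * s = a) (hb : 0 ≤ b)
    (h : Commute b s) : (a * b) ^ (1 / 2 : ℝ) = s * CFC.sqrt b := by
  have hc : Commute (CFC.sqrt b) s := commute_sqrt h
  rw [← CFC.sqrt_eq_rpow]
  refine CFC.sqrt_unique ?_ (Commute.mul_nonneg hs (CFC.sqrt_nonneg b) hc.symm)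
  rw [mul_assoc, ← mul_assoc _ s, hc.eq, mul_assoc, CFC.sqrt_mul_sqrt_self b hb, ← mul_assoc, hsa]

variable {T : (H →L[ℂ] H) →ₗ[ℂ] (K →L[ℂ] K)}

theorem isStatePair_alpha (hT : IsTwoPositive T) (htr : IsTracePreserving T) {D : H →L[ℂ] H}
    (hD : IsStrictlyPositive D) (hTD : IsStrictlyPositive (T D)) :
    IsStatePair (hsAdjoint T) (alpha T D) (T D) D where
  left := isSchwarz_hsAdjoint hT htr
  right := isSchwarz_alpha hT hD.nonneg hTD
  tr_left X := tr_mul_hsAdjoint hT.map_star D X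
  tr_right := tr_mul_alpha htr hD.nonneg hTD
  posK := hTD
  posH := hD

theorem isStatePair_recovery (hT : IsTwoPositive T) (htr : IsTracePreserving T) {D : H →L[ℂ] H}
    (hD : IsStrictlyPositive D) (hTD : IsStrictlyPositive (T D))
    {β : (K →L[ℂ] K) →ₗ[ℂ] (H →L[ℂ] H)} (hβ : IsTwoPositive β) (hβtr : IsTracePreserving β)
    (hβD : β (T D) = D) : IsStatePair (hsAdjoint T) (hsAdjoint β) (T D) D where
  left := isSchwarz_hsAdjoint hT htr
  right := isSchwarz_hsAdjoint hβ hβtr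
  tr_left X := tr_mul_hsAdjoint hT.map_star D X
  tr_right Z := by rw [tr_mul_hsAdjoint hβ.map_star, hβD]
  posK := hTD
  posH := hD

/-- The fixed points of `B ∘ T*`, for any `B` forming a state pair with `T*`, are fixed by
`α ∘ T*`. On these fixed points `T*` intertwines the conjugations by the square roots of `T D`
and `D`, since these square roots split along the fixed-point algebra. -/
theorem alpha_hsAdjoint_of_mem (hT : IsTwoPositive T) {D : H →L[ℂ] H}
    {B : (H →L[ℂ] H) →ₗ[ℂ] (K →L[ℂ] K)} (h : IsStatePair (hsAdjoint T) B (T D) D)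
    {Y : K →L[ℂ] K} (hY : Y ∈ h.fixedPoints) : alpha T D (hsAdjoint T Y) = Y := by
  obtain ⟨σ, R, R', hσF, hσ, hR, hR', hAσ, hρ, hD, hc, hc'⟩ := h.exists_factorization
  set A := hsAdjoint T with hA
  set s := CFC.sqrt σ with hs
  have hs0 : 0 ≤ s := CFC.sqrt_nonneg σ
  have hss : s * s = σ := CFC.sqrt_mul_sqrt_self σ hσ.nonneg
  have hsF : s ∈ h.fixedPoints := sqrt_mem _ hσ.nonneg hσF
  have hAss : A s * A s = A σ := by rw [← h.map_mul_left hsF, hss]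
  have hρh : (T D) ^ (1 / 2 : ℝ) = s * CFC.sqrt R := by
    rw [hρ, rpow_half_mul hs0 hss hR.nonneg (hc s hsF)]
  have hDh : D ^ (1 / 2 : ℝ) = A s * CFC.sqrt R' := by
    conv_lhs => rw [hD]
    rw [rpow_half_mul (h.left.map_nonneg hs0) hAss hR'.nonneg (hc' s hsF)]
  have hcs := commute_sqrt (hc s hsF)
  have hcY := commute_sqrt (hc Y hY)
  have hcs' := commute_sqrt (hc' s hsF)
  have hcY' := commute_sqrt (hc' Y hY)
  have hrr := CFC.sqrt_mul_sqrt_self R hR.nonneg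
  have hrr' := CFC.sqrt_mul_sqrt_self R' hR'.nonneg
  set r := CFC.sqrt R
  set r' := CFC.sqrt R'
  have key : T (D ^ (1 / 2 : ℝ) * A Y * D ^ (1 / 2 : ℝ)) =
      (T D) ^ (1 / 2 : ℝ) * Y * (T D) ^ (1 / 2 : ℝ) := by
    have hu : IsUnit s := (CFC.isUnit_sqrt_iff σ hσ.nonneg).2 hσ.isUnit
    refine eq_of_forall_tr_mul fun X => ?_
    -- Since `s` is invertible, test operators of the form `s X₁` suffice; the factor `s` then
    -- completes the two square roots to `T D` and `D` under the trace.
    obtain ⟨X, rfl⟩ : ∃ X₁, X = s * X₁ := by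
      obtain ⟨u, hu⟩ := hu
      exact ⟨↑u⁻¹ * X, by rw [← hu, Units.mul_inv_cancel_left]⟩
    have e1 : D ^ (1 / 2 : ℝ) * A Y * D ^ (1 / 2 : ℝ) = A s * A Y * (R' * A s) := by
      rw [hDh, mul_assoc (A s), hcY'.eq, ← hrr']
      simp only [mul_assoc]
      rw [← hcs'.eq]
    have e2 : (T D) ^ (1 / 2 : ℝ) * Y * (T D) ^ (1 / 2 : ℝ) = s * Y * (R * s) := by
      rw [hρh, mul_assoc s, hcY.eq, ← hrr]
      simp only [mul_assoc]
      rw [← hcs.eq]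
    have e3 : ∀ P Q S : K →L[ℂ] K, tr (s * P * (Q * (S * s))) = tr (σ * P * (Q * S)) := by
      intro P Q S
      rw [← hss, ← mul_assoc Q, ← mul_assoc, tr_mul_comm]
      simp only [mul_assoc]
    have e4 : ∀ P Q S : H →L[ℂ] H, tr (A s * P * (Q * (S * A s))) = tr (A σ * P * (Q * S)) := by
      intro P Q S
      rw [← hAss, ← mul_assoc Q, ← mul_assoc, tr_mul_comm]
      simp only [mul_assoc]
    rw [tr_mul_comm, ← tr_mul_hsAdjoint hT.map_star, tr_mul_comm, ← hA, e1, e2, h.map_mul_left hsF,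
      e3, e4, ← mul_assoc, tr_mul_comm, ← mul_assoc, ← mul_assoc, ← mul_assoc,
      (hc' σ hσF).eq, ← hD, mul_assoc D, mul_assoc D,
      ← h.map_mul_right hsF, ← h.map_mul_right hY, h.tr_left, hρ, ← (hc σ hσF).eq, mul_assoc R,
      tr_mul_comm R]
    simp only [mul_assoc]
  rw [alpha_apply, key]
  have h1 := CFC.rpow_neg_mul_rpow (1 / 2 : ℝ) h.posK
  have h2 := CFC.rpow_mul_rpow_neg (1 / 2 : ℝ) h.posK
  rw [mul_assoc, mul_assoc, h2, mul_one, ← mul_assoc, h1, one_mul]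

/-- For a sufficient `T`, the states `T (D s)` and `D s` split simultaneously along the
fixed-point algebra of `α ∘ T*`, with factors `R` and `T^# R` in the commutants that do not depend
on `s`. -/
theorem exists_common_factorization (hT : IsTwoPositive T) (htr : IsTracePreserving T)
    {D : Fin 2 → (H →L[ℂ] H)} (hD : ∀ s, IsStrictlyPositive (D s))
    (hTD : ∀ s, IsStrictlyPositive (T (D s))) (hsuff : IsSufficient T D)
    (h : IsStatePair (hsAdjoint T) (alpha T (D 0)) (T (D 0)) (D 0)) :
    ∃ (σ : Fin 2 → (K →L[ℂ] K)) (R : K →L[ℂ] K) (R' : H →L[ℂ] H),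
      (∀ s, σ s ∈ h.fixedPoints) ∧ (∀ s, IsStrictlyPositive (σ s)) ∧ IsStrictlyPositive R ∧
      IsStrictlyPositive R' ∧ (∀ s, T (D s) = σ s * R) ∧
      (∀ s, D s = hsAdjoint T (σ s) * R') ∧ (∀ Y ∈ h.fixedPoints, Commute R Y) ∧
      (∀ Y ∈ h.fixedPoints, Commute R' (hsAdjoint T Y)) ∧ R' = sharp T (D 0) R := by
  obtain ⟨β, hβtr, hβ, hβD⟩ := hsuff
  obtain ⟨σ, R, R', hσF, hσ, hR, hR', hAσ, hρ, hD0, hc, hc'⟩ := h.exists_factorization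
  have h' := isStatePair_recovery hT htr (hD 0) (hTD 0) hβ hβtr (hβD 0)
  obtain ⟨d, hd⟩ : ∃ d, T (D 1) = d * T (D 0) := by
    obtain ⟨u, hu⟩ := (hTD 0).isUnit
    exact ⟨T (D 1) * ↑u⁻¹, by rw [← hu, Units.inv_mul_cancel_right]⟩
  obtain ⟨hdF, hdD⟩ := h'.cocycle_mem (d := d) (D₂ := D 1)
    (fun X => by rw [← hd, tr_mul_hsAdjoint hT.map_star])
    (fun Z => by rw [← hd, tr_mul_hsAdjoint hβ.map_star, hβD])
  replace hdF : d ∈ h.fixedPoints := alpha_hsAdjoint_of_mem hT h' hdF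
  have hσ1F : d * σ ∈ h.fixedPoints := mul_mem hdF hσF
  have hρ1 : T (D 1) = d * σ * R := by rw [hd, mul_assoc, ← hρ]
  have hσ1 : IsStrictlyPositive (d * σ) :=
    isStrictlyPositive_of_mul_eq hR (hTD 1) (hρ1.trans (hc _ hσ1F).eq.symm) (hc _ hσ1F)
  refine ⟨![σ, d * σ], R, R', ?_, ?_, hR, hR', ?_, ?_, hc, hc', ?_⟩
  · exact Fin.forall_fin_two.2 ⟨hσF, hσ1F⟩
  · exact Fin.forall_fin_two.2 ⟨hσ, hσ1⟩
  · exact Fin.forall_fin_two.2 ⟨hρ, hρ1⟩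
  · refine Fin.forall_fin_two.2 ⟨hD0, ?_⟩
    show D 1 = hsAdjoint T (d * σ) * R'
    rw [h.map_mul_left hdF, mul_assoc, ← hD0, hdD]
  · refine eq_of_forall_tr_mul fun Z => ?_
    -- As `T*(σ)` is invertible, test operators of the form `Z₁ T*(σ)` suffice, and `T*(σ) R'`
    -- is `D 0`.
    obtain ⟨Z, rfl⟩ : ∃ Z₁, Z = Z₁ * hsAdjoint T σ := by
      obtain ⟨u, hu⟩ := hAσ.isUnit
      exact ⟨Z * ↑u⁻¹, by rw [← hu, Units.inv_mul_cancel_right]⟩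
    rw [sharp, tr_mul_hsAdjoint h.right.map_star, h.symm.map_mul_right (h.map_mem hσF),
      h.mem_fixedPoints.1 hσF, mul_assoc, mul_assoc, ← hρ, ← hD0, tr_mul_comm, ← h.tr_right,
      tr_mul_comm]

end Petz

/-! ### Minimal projections and the trace on a factor -/

section Minimal

variable {K : Type*} [NormedAddCommGroup K] [InnerProductSpace ℂ K] [FiniteDimensional ℂ K]
  [CompleteSpace K]

theorem tr_ne_zero_of_isStarProjection {e : K →L[ℂ] K} (he : IsStarProjection e) (h0 : e ≠ 0) :
    tr e ≠ 0 := by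
  intro h
  apply h0
  apply eq_zero_of_tr_star_mul_self
  rw [he.isSelfAdjoint.star_eq, he.isIdempotentElem.eq, h]

theorem exists_isMinimalProjectionIn (A : Set (K →L[ℂ] K)) {f : K →L[ℂ] K} (hfA : f ∈ A)
    (hf : IsStarProjection f) (hf0 : f ≠ 0) : ∃ e, IsMinimalProjectionIn A e ∧ e ≤ f := by
  induction hn : Module.finrank ℂ (f : K →ₗ[ℂ] K).range using Nat.strong_induction_on
    generalizing f with
  | _ n ih =>
    by_cases hmin : ∀ g ∈ A, IsStarProjection g → g ≤ f → g = 0 ∨ g = f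
    · exact ⟨f, ⟨hfA, hf, hf0, hmin⟩, le_rfl⟩
    · push Not at hmin
      obtain ⟨g, hgA, hg, hgf, hg0, hne⟩ := hmin
      have hle : (g : K →ₗ[ℂ] K).range ≤ (f : K →ₗ[ℂ] K).range := by
        rintro _ ⟨x, rfl⟩
        refine ⟨g x, ?_⟩
        have := (hg.le_iff_mul_eq_right hf).1 hgf
        exact congrArg (fun a : K →L[ℂ] K => a x) this
      have hlt : (g : K →ₗ[ℂ] K).range < (f : K →ₗ[ℂ] K).range :=
        lt_of_le_of_ne hle fun h =>
          hne ((ContinuousLinearMap.IsStarProjection.ext_iff hg hf).2 h)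
      obtain ⟨e, he, heg⟩ := ih _ (hn ▸ Submodule.finrank_lt_finrank_of_lt hlt) hgA hg hg0 rfl
      exact ⟨e, he, heg.trans hgf⟩

theorem finite_real_spectrum (y : K →L[ℂ] K) : (spectrum ℝ y).Finite := by
  rcases subsingleton_or_nontrivial (K →L[ℂ] K) with _ | _
  · rw [spectrum.of_subsingleton]
    exact Set.finite_empty
  have hfin : Module.Finite ℝ (K →L[ℂ] K) := Module.Finite.trans ℂ _
  have hint : IsIntegral ℝ y := Algebra.IsIntegral.isIntegral y
  refine (Polynomial.rootSet_finite (minpoly ℝ y) ℝ).subset fun k hk => ?_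
  rw [Polynomial.mem_rootSet]
  refine ⟨minpoly.ne_zero hint, ?_⟩
  have h1 := spectrum.subset_polynomial_aeval y (minpoly ℝ y) ⟨k, hk, rfl⟩
  rw [minpoly.aeval, spectrum.zero_eq] at h1
  simpa using h1

/-- A minimal projection `e` of a star subalgebra compresses it to scalars: a nonzero
self-adjoint `e x e` has a spectral projection at a nonzero eigenvalue, which lies below `e` and
hence equals `e`. -/
theorem IsMinimalProjectionIn.compress_isSelfAdjoint {F : StarSubalgebra ℂ (K →L[ℂ] K)}
    {e : K →L[ℂ] K} (he : IsMinimalProjectionIn (F : Set (K →L[ℂ] K)) e) {x : K →L[ℂ] K}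
    (hx : x ∈ F) (hsa : IsSelfAdjoint x) : ∃ c : ℂ, e * x * e = c • e := by
  obtain ⟨heF, hep, he0, hmin⟩ := he
  have hestar := hep.isSelfAdjoint.star_eq
  set y := e * x * e with hy
  have hyF : y ∈ F := mul_mem (mul_mem heF hx) heF
  have hysa : IsSelfAdjoint y := by
    rw [isSelfAdjoint_iff, hy, star_mul, star_mul, hestar, hsa.star_eq, mul_assoc]
  by_cases hy0 : y = 0
  · exact ⟨0, by rw [hy0, zero_smul]⟩
  obtain ⟨c, hc, hc0⟩ : ∃ c ∈ spectrum ℝ y, c ≠ 0 := by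
    by_contra! hcon
    exact hy0 (CFC.eq_zero_of_spectrum_subset_zero (R := ℝ) y (fun c hc => hcon c hc) hysa)
  have hcont : ∀ f : ℝ → ℝ, ContinuousOn f (spectrum ℝ y) := fun f =>
    (finite_real_spectrum y).continuousOn f
  set f : ℝ → ℝ := fun t => if t = c then 1 else 0 with hf
  have hcl := isClosed_starSubalgebra F
  have hPF : cfc f y ∈ F := cfc_mem f hyF
  have hPp : IsStarProjection (cfc f y) := by
    refine ⟨?_, cfc_predicate f y⟩
    rw [IsIdempotentElem, ← cfc_mul f f y (hcont f) (hcont f)]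
    congr 1
    ext t
    simp [hf]
  have hyP : y * cfc f y = c • cfc f y := by
    rw [← cfc_smul c f y (hcont f)]
    conv_lhs =>
      enter [1]
      rw [← cfc_id ℝ y hysa]
    rw [← cfc_mul id f y (hcont _) (hcont f)]
    congr 1
    ext t
    by_cases ht : t = c <;> simp [hf, ht]
  have hey : e * y = y := by rw [hy, ← mul_assoc, ← mul_assoc, hep.isIdempotentElem.eq]
  have heP : e * cfc f y = cfc f y := by
    have h1 : cfc f y = c⁻¹ • (y * cfc f y) := by rw [hyP, inv_smul_smul₀ hc0]
    rw [h1, mul_smul_comm, ← mul_assoc, hey]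
  have hP0 : cfc f y ≠ 0 := by
    intro h0
    rw [← cfc_const_zero ℝ y, cfc_eq_cfc_iff_eqOn (ha := hysa) (hf := hcont _) (hg := hcont _)] at h0
    have := h0 hc
    simp [hf] at this
  have hPe : cfc f y = e :=
    (hmin _ hPF hPp ((hPp.le_iff_mul_eq_right hep).2 heP)).resolve_left hP0
  refine ⟨c, ?_⟩
  have hye : y * e = y := by rw [hy, mul_assoc, hep.isIdempotentElem.eq]
  rw [← hye, ← hPe, hyP]
  rfl

theorem IsMinimalProjectionIn.compress {F : StarSubalgebra ℂ (K →L[ℂ] K)} {e : K →L[ℂ] K}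
    (he : IsMinimalProjectionIn (F : Set (K →L[ℂ] K)) e) {x : K →L[ℂ] K} (hx : x ∈ F) :
    ∃ c : ℂ, e * x * e = c • e := by
  have hre : (realPart x : K →L[ℂ] K) ∈ F := by
    rw [realPart_apply_coe, ← Complex.coe_smul]
    exact F.smul_mem (add_mem hx (star_mem hx)) _
  have him : (imaginaryPart x : K →L[ℂ] K) ∈ F := by
    rw [imaginaryPart_apply_coe, ← Complex.coe_smul]
    exact F.smul_mem (F.smul_mem (sub_mem hx (star_mem hx)) _) _
  obtain ⟨a, ha⟩ := he.compress_isSelfAdjoint hre (realPart x).2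
  obtain ⟨b, hb⟩ := he.compress_isSelfAdjoint him (imaginaryPart x).2
  refine ⟨a + Complex.I * b, ?_⟩
  conv_lhs => rw [← realPart_add_I_smul_imaginaryPart x]
  rw [mul_add, add_mul, ha, mul_smul_comm, smul_mul_assoc, hb, add_smul, mul_smul]

theorem coe_centralizer_starSubalgebra (F : StarSubalgebra ℂ (K →L[ℂ] K)) :
    (StarSubalgebra.centralizer ℂ (F : Set (K →L[ℂ] K)) : Set (K →L[ℂ] K)) =
      Set.centralizer (F : Set (K →L[ℂ] K)) := by
  rw [StarSubalgebra.coe_centralizer]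
  congr 1
  refine Set.union_eq_left.2 fun x hx => ?_
  have := star_mem (S := StarSubalgebra ℂ (K →L[ℂ] K)) (s := F) hx
  rwa [star_star] at this

theorem coe_center_starSubalgebra (F : StarSubalgebra ℂ (K →L[ℂ] K)) :
    ((F ⊓ StarSubalgebra.centralizer ℂ (F : Set (K →L[ℂ] K)) : StarSubalgebra ℂ (K →L[ℂ] K)) :
      Set (K →L[ℂ] K)) = (F : Set (K →L[ℂ] K)) ∩ Set.centralizer (F : Set (K →L[ℂ] K)) := by
  rw [StarSubalgebra.coe_inf, coe_centralizer_starSubalgebra]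

section Central

variable {F : StarSubalgebra ℂ (K →L[ℂ] K)} {z : K →L[ℂ] K}

/-- Traces on a factor are proportional. The density in `F` of a functional that is tracial on `F`
is central, hence a scalar on the summand of `z`. -/
theorem IsMinimalCentralProjection.exists_eq_mul_tr
    (hz : IsMinimalCentralProjection (F : Set (K →L[ℂ] K)) z) (τ : (K →L[ℂ] K) →ₗ[ℂ] ℂ)
    (hτ : ∀ x ∈ F, ∀ y ∈ F, τ (x * y) = τ (y * x)) :
    ∃ c : ℂ, ∀ x ∈ F, τ (z * x) = c * tr (z * x) := by
  obtain ⟨w, hwF, hw⟩ := exists_mem_tr_mul F τ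
  have hcomm : ∀ a ∈ F, a * w = w * a := by
    intro a ha
    refine (eq_of_mem_of_forall_tr_mul (mul_mem hwF ha) (mul_mem ha hwF) fun x hx => ?_).symm
    rw [tr_mul_comm, mul_assoc, ← hw _ (mul_mem ha hx), hτ a ha x hx, hw _ (mul_mem hx ha),
      tr_mul_comm, mul_assoc]
  rw [IsMinimalCentralProjection, ← coe_center_starSubalgebra] at hz
  have hwZ : w ∈ (F ⊓ StarSubalgebra.centralizer ℂ (F : Set (K →L[ℂ] K)) :
      StarSubalgebra ℂ (K →L[ℂ] K)) := by
    rw [← SetLike.mem_coe, coe_center_starSubalgebra]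
    exact ⟨hwF, fun a ha => hcomm a ha⟩
  obtain ⟨c, hc⟩ := hz.compress hwZ
  have hzF : z ∈ F := hz.1.1
  refine ⟨c, fun x hx => ?_⟩
  rw [hw _ (mul_mem hzF hx), ← mul_assoc, ← hcomm z hzF]
  have : z * w = c • z := by
    rw [← hc, mul_assoc, ← hcomm z hzF, ← mul_assoc, hz.2.1.isIdempotentElem.eq]
  rw [this, smul_mul_assoc, tr_smul]

theorem IsMinimalCentralProjection.tr_mul_mul_tr
    (hz : IsMinimalCentralProjection (F : Set (K →L[ℂ] K)) z) {x y : K →L[ℂ] K} (hx : x ∈ F)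
    (hy : y ∈ Set.centralizer (F : Set (K →L[ℂ] K))) :
    tr (z * x * y) * tr z = tr (z * x) * tr (z * y) := by
  obtain ⟨c, hc⟩ := hz.exists_eq_mul_tr (trₗ ∘ₗ LinearMap.mulRight ℂ y) (by
    intro a ha b hb
    show tr (a * b * y) = tr (b * a * y)
    rw [mul_assoc, hy b hb, ← mul_assoc, tr_mul_comm, ← mul_assoc])
  have h1 := hc x hx
  have h2 := hc 1 (one_mem F)
  rw [mul_one] at h2
  replace h1 : tr (z * x * y) = c * tr (z * x) := h1
  replace h2 : tr (z * y) = c * tr z := h2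
  rw [h1, h2]
  ring

/-- A projection that is minimal in a summand is minimal in the whole algebra. -/
theorem IsMinimalProjectionIn.of_corner {G : StarSubalgebra ℂ (K →L[ℂ] K)} {e : K →L[ℂ] K}
    (hzG : z ∈ G) (hz : IsStarProjection z)
    (he : IsMinimalProjectionIn (corner z (G : Set (K →L[ℂ] K))) e) :
    IsMinimalProjectionIn (G : Set (K →L[ℂ] K)) e ∧ z * e = e := by
  obtain ⟨⟨a, ha, hae⟩, hep, he0, hmin⟩ := he
  replace hae : z * a = e := hae
  have hze : z * e = e := by rw [← hae, ← mul_assoc, hz.isIdempotentElem.eq]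
  refine ⟨⟨hae ▸ mul_mem hzG ha, hep, he0, fun f hf hfp hfe => hmin f ⟨f, hf, ?_⟩ hfp hfe⟩, hze⟩
  have h1 := (hfp.le_iff_mul_eq_right hep).1 hfe
  show z * f = f
  rw [← h1, ← mul_assoc, hze]

theorem exists_isMinimalProjectionIn_corner {G : StarSubalgebra ℂ (K →L[ℂ] K)}
    (hz : IsStarProjection z) (hz0 : z ≠ 0) :
    ∃ e, IsMinimalProjectionIn (corner z (G : Set (K →L[ℂ] K))) e := by
  obtain ⟨e, he, -⟩ := exists_isMinimalProjectionIn (corner z (G : Set (K →L[ℂ] K)))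
    ⟨1, one_mem G, mul_one z⟩ hz hz0
  exact ⟨e, he⟩

/-- For minimal projections `e` of the factor `z F` and `e'` of its commutant, `e e'` has rank one:
for a vector `v` in its range, the projection onto `F v` lies in the commutant, so it is `e'`, and
`e F v = e F e v` is spanned by `v`. -/
theorem IsMinimalCentralProjection.tr_mul_eq_one
    (hz : IsMinimalCentralProjection (F : Set (K →L[ℂ] K)) z) {e e' : K →L[ℂ] K}
    (he : IsMinimalProjectionIn (F : Set (K →L[ℂ] K)) e) (hze : z * e = e)
    (he' : IsMinimalProjectionIn (Set.centralizer (F : Set (K →L[ℂ] K))) e') (hze' : z * e' = e') :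
    tr (e * e') = 1 := by
  have hcomm : ∀ a ∈ F, a * e' = e' * a := fun a ha => he'.1 a ha
  have hep := he.2.1
  have hep' := he'.2.1
  have hne : e * e' ≠ 0 := by
    intro h0
    have h1 := hz.tr_mul_mul_tr he.1 he'.1
    rw [hze, hze', h0, tr_zero, zero_mul] at h1
    exact mul_ne_zero (tr_ne_zero_of_isStarProjection hep he.2.2.1)
      (tr_ne_zero_of_isStarProjection hep' he'.2.2.1) h1.symm
  obtain ⟨v₀, hv₀⟩ : ∃ v, (e * e') v ≠ 0 := by
    by_contra! hcon
    exact hne (ContinuousLinearMap.ext hcon)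
  set v := (e * e') v₀ with hv
  have hev : e v = v := by
    rw [hv, ← op_mul_apply, ← mul_assoc, hep.isIdempotentElem.eq]
  have hev' : e' v = v := by
    rw [hv, ← op_mul_apply, ← mul_assoc, ← hcomm e he.1, mul_assoc, hep'.isIdempotentElem.eq]
  set W : Submodule ℂ K :=
    (Subalgebra.toSubmodule F.toSubalgebra).map
      ((ContinuousLinearMap.apply ℂ K v : (K →L[ℂ] K) →L[ℂ] K) : (K →L[ℂ] K) →ₗ[ℂ] K) with hW
  have hmemW : ∀ u, u ∈ W ↔ ∃ f ∈ F, f v = u := fun u => Iff.rfl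
  have hinv : ∀ a ∈ F, ∀ u ∈ W, a u ∈ W := by
    rintro a ha u hu
    obtain ⟨f, hf, rfl⟩ := (hmemW u).1 hu
    exact (hmemW _).2 ⟨a * f, mul_mem ha hf, rfl⟩
  set P := W.starProjection with hP
  have hPp : IsStarProjection P := isStarProjection_starProjection
  have hPmem : ∀ u, P u ∈ W := fun u => W.starProjection_apply_mem u
  have hPid : ∀ u ∈ W, P u = u := fun u hu => Submodule.starProjection_eq_self_iff.2 hu
  have hPaP : ∀ a ∈ F, P * (a * P) = a * P := fun a ha =>
    ContinuousLinearMap.ext fun u => hPid _ (hinv a ha _ (hPmem u))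
  have hPF : P ∈ Set.centralizer (F : Set (K →L[ℂ] K)) := by
    intro a ha
    have h1 := congrArg star (hPaP (star a) (star_mem ha))
    simp only [star_mul, star_star, hPp.isSelfAdjoint.star_eq] at h1
    rw [← hPaP a ha, ← mul_assoc, h1]
  have hvW : v ∈ W := (hmemW v).2 ⟨1, one_mem F, rfl⟩
  have hPe' : P ≤ e' := by
    rw [hPp.le_iff_mul_eq_right hep']
    refine ContinuousLinearMap.ext fun u => ?_
    obtain ⟨f, hf, hfu⟩ := (hmemW _).1 (hPmem u)
    rw [op_mul_apply, ← hfu, ← op_mul_apply, ← hcomm f hf, op_mul_apply, hev']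
  have hP0 : P ≠ 0 := by
    intro h0
    apply hv₀
    rw [← hPid v hvW, h0]
    rfl
  have hPeq : P = e' := (he'.2.2.2 P hPF hPp hPe').resolve_left hP0
  have hproj : LinearMap.IsProj (ℂ ∙ v) ((e * e' : K →L[ℂ] K) : K →ₗ[ℂ] K) := by
    constructor
    · intro u
      obtain ⟨f, hf, hfu⟩ := (hmemW _).1 (hPmem u)
      obtain ⟨c, hc⟩ := he.compress hf
      refine Submodule.mem_span_singleton.2 ⟨c, ?_⟩
      show c • v = e (e' u)
      rw [← hPeq, ← hfu]
      conv_rhs => rw [← hev]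
      rw [← op_mul_apply f, ← op_mul_apply, ← mul_assoc, hc, smul_apply, hev]
    · intro u hu
      obtain ⟨c, rfl⟩ := Submodule.mem_span_singleton.1 hu
      show (e * e') (c • v) = c • v
      rw [map_smul, op_mul_apply, hev', hev]
  have := hproj.trace
  rw [finrank_span_singleton hv₀, Nat.cast_one] at this
  exact this

/-- The traces of the minimal projections of the factor `z F ≅ M_n ⊗ 1_m` and of its commutant
`1_n ⊗ M_m` multiply to the trace of `z`. -/
theorem IsMinimalCentralProjection.tr_mul_tr
    (hz : IsMinimalCentralProjection (F : Set (K →L[ℂ] K)) z) {e e' : K →L[ℂ] K}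
    (he : IsMinimalProjectionIn (corner z (F : Set (K →L[ℂ] K))) e)
    (he' : IsMinimalProjectionIn (corner z (Set.centralizer (F : Set (K →L[ℂ] K)))) e') :
    tr e * tr e' = tr z := by
  obtain ⟨h1, h2⟩ := he.of_corner hz.1.1 hz.2.1
  rw [← coe_centralizer_starSubalgebra] at he'
  obtain ⟨h3, h4⟩ := he'.of_corner
    (by
      rw [← SetLike.mem_coe, coe_centralizer_starSubalgebra]
      exact hz.1.2) hz.2.1
  rw [coe_centralizer_starSubalgebra] at h3
  have := hz.tr_mul_mul_tr h1.1 h3.1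
  rw [h2, h4, hz.tr_mul_eq_one h1 h2 h3 h4, one_mul] at this
  exact this.symm

end Central

end Minimal

/-! ### The minimal central projections -/

section Central

variable {K : Type*} [NormedAddCommGroup K] [InnerProductSpace ℂ K] [FiniteDimensional ℂ K]
  [CompleteSpace K] {F : StarSubalgebra ℂ (K →L[ℂ] K)}

theorem isStarProjection_mul_of_commute {e f : K →L[ℂ] K} (he : IsStarProjection e)
    (hf : IsStarProjection f) (h : e * f = f * e) : IsStarProjection (e * f) := by
  refine ⟨?_, ?_⟩
  · rw [IsIdempotentElem, mul_assoc, ← mul_assoc f, ← h, mul_assoc, hf.isIdempotentElem.eq,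
      ← mul_assoc, he.isIdempotentElem.eq]
  · rw [isSelfAdjoint_iff, star_mul, he.isSelfAdjoint.star_eq, hf.isSelfAdjoint.star_eq, h]

theorem IsMinimalCentralProjection.mul_eq_zero {e f : K →L[ℂ] K}
    (he : IsMinimalCentralProjection (F : Set (K →L[ℂ] K)) e)
    (hf : IsMinimalCentralProjection (F : Set (K →L[ℂ] K)) f) (hne : e ≠ f) : e * f = 0 := by
  have hc : e * f = f * e := hf.1.2 e he.1.1
  have hp := isStarProjection_mul_of_commute he.2.1 hf.2.1 hc
  have hmem : e * f ∈ (F : Set (K →L[ℂ] K)) ∩ Set.centralizer (F : Set (K →L[ℂ] K)) :=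
    ⟨mul_mem he.1.1 hf.1.1, Set.mul_mem_centralizer he.1.2 hf.1.2⟩
  have h1 := he.2.2.2 _ hmem hp ((hp.le_iff_mul_eq_right he.2.1).2 (by
    rw [← mul_assoc, he.2.1.isIdempotentElem.eq]))
  have h2 := hf.2.2.2 _ hmem hp ((hp.le_iff_mul_eq_left hf.2.1).2 (by
    rw [mul_assoc, hf.2.1.isIdempotentElem.eq]))
  rcases h1 with h1 | h1
  · exact h1
  · rcases h2 with h2 | h2
    · exact h2
    · exact absurd (h1.symm.trans h2) hne

variable (F) in
/-- There are finitely many minimal central projections, since they are orthogonal, and they sum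
to one. -/
theorem exists_enum_isMinimalCentralProjection :
    ∃ (r : ℕ) (z : Fin r → (K →L[ℂ] K)), Function.Injective z ∧
      Set.range z = {e | IsMinimalCentralProjection (F : Set (K →L[ℂ] K)) e} ∧ ∑ p, z p = 1 := by
  set E : Set (K →L[ℂ] K) := {e | IsMinimalCentralProjection (F : Set (K →L[ℂ] K)) e} with hE
  have hlin : LinearIndependent ℂ (fun e : E => (e : K →L[ℂ] K)) := by
    rw [linearIndependent_iff']
    intro s g hg i hi
    have h1 := congrArg (fun a => (i : K →L[ℂ] K) * a) hg
    simp only [Finset.mul_sum, mul_zero, mul_smul_comm] at h1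
    rw [Finset.sum_eq_single i] at h1
    · rw [i.2.2.1.isIdempotentElem.eq] at h1
      exact (smul_eq_zero.1 h1).resolve_right i.2.2.2.1
    · intro j _ hj
      rw [i.2.mul_eq_zero j.2 (fun h => hj (Subtype.ext h.symm)), smul_zero]
    · exact fun h => absurd hi h
  have hfin : Finite E := hlin.finite
  let eqv := Finite.equivFin E
  set z : Fin (Nat.card E) → (K →L[ℂ] K) := fun p => (eqv.symm p : K →L[ℂ] K) with hz
  have hzE : ∀ p, IsMinimalCentralProjection (F : Set (K →L[ℂ] K)) (z p) := fun p =>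
    (eqv.symm p).2
  have hinj : Function.Injective z := Subtype.val_injective.comp eqv.symm.injective
  have hrange : Set.range z = E := by
    rw [hz, ← Function.comp_def, Set.range_comp, eqv.symm.range_eq_univ, Set.image_univ,
      Subtype.range_coe]
  refine ⟨_, z, hinj, hrange, ?_⟩
  set u := ∑ p, z p with hu
  have hmul : ∀ p, z p * u = z p := by
    intro p
    rw [hu, Finset.mul_sum, Finset.sum_eq_single p, (hzE p).2.1.isIdempotentElem.eq]
    · intro j _ hj
      exact (hzE p).mul_eq_zero (hzE j) (fun h => hj (hinj h.symm))
    · exact fun h => absurd (Finset.mem_univ p) h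
  have huu : IsStarProjection u := by
    refine ⟨?_, ?_⟩
    · show u * u = u
      conv_lhs =>
        enter [1]
        rw [hu]
      rw [Finset.sum_mul]
      exact Finset.sum_congr rfl fun p _ => hmul p
    · rw [isSelfAdjoint_iff, hu, star_sum]
      exact Finset.sum_congr rfl fun p _ => (hzE p).2.1.isSelfAdjoint.star_eq
  by_contra hne
  have hmem : 1 - u ∈ (F : Set (K →L[ℂ] K)) ∩ Set.centralizer (F : Set (K →L[ℂ] K)) := by
    rw [← coe_center_starSubalgebra]
    refine sub_mem (one_mem _) (sum_mem fun p _ => ?_)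
    rw [← SetLike.mem_coe, coe_center_starSubalgebra]
    exact (hzE p).1
  obtain ⟨e, he, hle⟩ := exists_isMinimalProjectionIn _ hmem huu.one_sub
    (sub_ne_zero.2 (Ne.symm hne))
  obtain ⟨p, rfl⟩ : e ∈ Set.range z := by
    rw [hrange]
    exact he
  have h1 := (he.2.1.le_iff_mul_eq_left huu.one_sub).1 hle
  rw [mul_sub, mul_one, hmul, sub_self] at h1
  exact he.2.2.1 h1.symm

end Central

section Transfer

variable {H K : Type*} [NormedAddCommGroup H] [InnerProductSpace ℂ H] [FiniteDimensional ℂ H]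
  [CompleteSpace H] [NormedAddCommGroup K] [InnerProductSpace ℂ K] [FiniteDimensional ℂ K]
  [CompleteSpace K]
  {A : (K →L[ℂ] K) →ₗ[ℂ] (H →L[ℂ] H)} {B : (H →L[ℂ] H) →ₗ[ℂ] (K →L[ℂ] K)}
  {ρ : K →L[ℂ] K} {D : H →L[ℂ] H}

theorem IsStatePair.isStarProjection_map (h : IsStatePair A B ρ D) {e : K →L[ℂ] K}
    (heF : e ∈ h.fixedPoints) (he : IsStarProjection e) : IsStarProjection (A e) := by
  refine ⟨?_, ?_⟩
  · rw [IsIdempotentElem, ← h.map_mul_left heF, he.isIdempotentElem.eq]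
  · rw [isSelfAdjoint_iff, ← h.left.map_star, he.isSelfAdjoint.star_eq]

/-- Minimal projections correspond under the isomorphism `A` of the fixed-point algebras. -/
theorem IsStatePair.map_isMinimalProjectionIn (h : IsStatePair A B ρ D) {S : Set (K →L[ℂ] K)}
    {S' : Set (H →L[ℂ] H)} (hS : ∀ x ∈ S, x ∈ h.fixedPoints)
    (hS' : ∀ x ∈ S', x ∈ h.symm.fixedPoints) (hA : ∀ x ∈ S, A x ∈ S') (hB : ∀ x ∈ S', B x ∈ S)
    {e : K →L[ℂ] K} (he : IsMinimalProjectionIn S e) : IsMinimalProjectionIn S' (A e) := by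
  obtain ⟨heS, hep, he0, hmin⟩ := he
  have heF := h.mem_fixedPoints.1 (hS e heS)
  refine ⟨hA e heS, h.isStarProjection_map heF hep, ?_, ?_⟩
  · intro h0
    rw [h0, map_zero] at heF
    exact he0 heF.symm
  · intro f hfS hfp hfe
    have hfF := h.symm.mem_fixedPoints.1 (hS' f hfS)
    have hBp := h.symm.isStarProjection_map hfF hfp
    have h1 := (hfp.le_iff_mul_eq_right (h.isStarProjection_map heF hep)).1 hfe
    have h2 : B f ≤ e := by
      rw [hBp.le_iff_mul_eq_right hep]
      conv_lhs => rw [← heF]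
      rw [← h.symm.map_mul_right hfF, h1]
    rcases hmin (B f) (hB f hfS) hBp h2 with h3 | h3
    · left
      rw [← hfF, h3, map_zero]
    · right
      rw [← hfF, h3]

theorem IsStatePair.map_mem_centralizer (h : IsStatePair A B ρ D) {y : K →L[ℂ] K}
    (hyF : y ∈ h.fixedPoints)
    (hy : y ∈ Set.centralizer (h.fixedPoints : Set (K →L[ℂ] K))) :
    A y ∈ Set.centralizer (h.symm.fixedPoints : Set (H →L[ℂ] H)) := by
  intro x hx
  have hxF := h.symm.mem_fixedPoints.1 hx
  rw [← hxF, ← h.map_mul_right hyF, ← h.map_mul_left hyF, hy _ (h.symm.map_mem hx)]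

theorem IsStatePair.map_isMinimalCentralProjection (h : IsStatePair A B ρ D) {z : K →L[ℂ] K}
    (hz : IsMinimalCentralProjection (h.fixedPoints : Set (K →L[ℂ] K)) z) :
    IsMinimalCentralProjection (h.symm.fixedPoints : Set (H →L[ℂ] H)) (A z) :=
  h.map_isMinimalProjectionIn
    (S := (h.fixedPoints : Set (K →L[ℂ] K)) ∩ Set.centralizer h.fixedPoints)
    (S' := (h.symm.fixedPoints : Set (H →L[ℂ] H)) ∩ Set.centralizer h.symm.fixedPoints)
    (fun _ hx => hx.1) (fun _ hx => hx.1)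
    (fun _ hx => ⟨h.map_mem hx.1, h.map_mem_centralizer hx.1 hx.2⟩)
    (fun _ hx => ⟨h.symm.map_mem hx.1, h.symm.map_mem_centralizer hx.1 hx.2⟩) hz

theorem IsStatePair.map_mem_corner (h : IsStatePair A B ρ D) {z x : K →L[ℂ] K}
    (hz : z ∈ h.fixedPoints) (hx : x ∈ corner z (h.fixedPoints : Set (K →L[ℂ] K))) :
    A x ∈ corner (A z) (h.symm.fixedPoints : Set (H →L[ℂ] H)) := by
  obtain ⟨a, ha, rfl⟩ := hx
  exact ⟨A a, h.map_mem ha, (h.map_mul_left hz a).symm⟩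

theorem mem_of_mem_corner {F : StarSubalgebra ℂ (K →L[ℂ] K)} {z x : K →L[ℂ] K} (hz : z ∈ F)
    (hx : x ∈ corner z (F : Set (K →L[ℂ] K))) : x ∈ F := by
  obtain ⟨a, ha, rfl⟩ := hx
  exact mul_mem hz ha

theorem IsStatePair.map_isMinimalProjectionIn_corner (h : IsStatePair A B ρ D) {z e : K →L[ℂ] K}
    (hz : z ∈ h.fixedPoints)
    (he : IsMinimalProjectionIn (corner z (h.fixedPoints : Set (K →L[ℂ] K))) e) :
    IsMinimalProjectionIn (corner (A z) (h.symm.fixedPoints : Set (H →L[ℂ] H))) (A e) := by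
  refine h.map_isMinimalProjectionIn (fun x hx => mem_of_mem_corner hz hx)
    (fun x hx => mem_of_mem_corner (h.map_mem hz) hx) (fun x hx => h.map_mem_corner hz hx)
    (fun x hx => ?_) he
  have := h.symm.map_mem_corner (h.map_mem hz) hx
  rwa [h.mem_fixedPoints.1 hz] at this

/-- `A` rescales the trace by a constant on each simple summand of the fixed-point algebra. -/
theorem IsStatePair.exists_tr_map_eq (h : IsStatePair A B ρ D) {z : K →L[ℂ] K}
    (hz : IsMinimalCentralProjection (h.fixedPoints : Set (K →L[ℂ] K)) z) :
    ∃ c : ℂ, ∀ x ∈ h.fixedPoints, tr (A (z * x)) = c * tr (z * x) :=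
  hz.exists_eq_mul_tr (trₗ ∘ₗ A) fun x hx y hy => by
    show tr (A (x * y)) = tr (A (y * x))
    rw [h.map_mul_left hx, tr_mul_comm, ← h.map_mul_right hx]

end Transfer

/-! ### The decomposition along the simple summands -/

section Blocks

variable {K : Type*} [NormedAddCommGroup K] [InnerProductSpace ℂ K] [FiniteDimensional ℂ K]
  [CompleteSpace K]

theorem complex_div_nonneg {a b : ℂ} (ha : 0 ≤ a) (hb : 0 ≤ b) : 0 ≤ a / b := by
  rw [Complex.eq_re_of_ofReal_le ha, Complex.eq_re_of_ofReal_le hb, ← Complex.ofReal_div]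
  exact Complex.zero_le_real.2 (div_nonneg (Complex.nonneg_iff.1 ha).1 (Complex.nonneg_iff.1 hb).1)

theorem complex_smul_nonneg {c : ℂ} {A : K →L[ℂ] K} (hc : 0 ≤ c) (hA : 0 ≤ A) : 0 ≤ c • A := by
  rw [nonneg_iff_inner] at hA ⊢
  intro x
  rw [smul_apply, inner_smul_right]
  exact mul_nonneg hc (hA x)

theorem tr_mul_ne_zero {D z : K →L[ℂ] K} (hD : IsStrictlyPositive D) (hz : IsStarProjection z)
    (hz0 : z ≠ 0) : tr (z * D) ≠ 0 := by
  intro h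
  rw [tr_mul_comm] at h
  exact hz0 (eq_zero_of_tr_mul_eq_zero hD hz.nonneg h)

/-- A multiple of `z a` that is a density operator of `z G` as soon as it has the trace of the
minimal projections. -/
theorem isDensityIn_corner {G : StarSubalgebra ℂ (K →L[ℂ] K)} {z a : K →L[ℂ] K} {c t : ℂ}
    (hz : IsStarProjection z) (ha : a ∈ G) (ha0 : 0 ≤ a) (hc : Commute z a) (hc0 : 0 ≤ c)
    (htr : c * tr (z * a) = t)
    (ht : ∀ e, IsMinimalProjectionIn (corner z (G : Set (K →L[ℂ] K))) e → tr e = t) :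
    IsDensityIn (corner z (G : Set (K →L[ℂ] K))) (c • (z * a)) := by
  refine ⟨⟨c • a, G.smul_mem ha c, mul_smul_comm _ _ _⟩,
    complex_smul_nonneg hc0 (Commute.mul_nonneg hz.nonneg ha0 hc), fun e he => ?_⟩
  rw [tr_smul, htr, ht e he]

end Blocks

section Main

variable {H K : Type*} [NormedAddCommGroup H] [InnerProductSpace ℂ H] [FiniteDimensional ℂ H]
  [CompleteSpace H] [NormedAddCommGroup K] [InnerProductSpace ℂ K] [FiniteDimensional ℂ K]
  [CompleteSpace K]
  {T : (H →L[ℂ] H) →ₗ[ℂ] (K →L[ℂ] K)}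

/-- `T^#` is a module map over the fixed points: `T^#(Y R) = T*(Y) T^#(R)`. -/
theorem sharp_mul {D : H →L[ℂ] H}
    (h : IsStatePair (hsAdjoint T) (alpha T D) (T D) D) {Y : K →L[ℂ] K} (hY : Y ∈ h.fixedPoints)
    (R : K →L[ℂ] K) : sharp T D (Y * R) = hsAdjoint T Y * sharp T D R := by
  refine eq_of_forall_tr_mul fun Z => ?_
  rw [sharp, tr_mul_hsAdjoint h.right.map_star, ← mul_assoc Z,
    tr_mul_hsAdjoint h.right.map_star, h.symm.map_mul_right (h.map_mem hY),
    h.mem_fixedPoints.1 hY, mul_assoc]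

theorem tr_sharp {D : H →L[ℂ] H}
    (h : IsStatePair (hsAdjoint T) (alpha T D) (T D) D) (X : K →L[ℂ] K) :
    tr (sharp T D X) = tr X := by
  have := tr_mul_hsAdjoint h.right.map_star 1 X
  rwa [h.right.map_one, one_mul, one_mul] at this

end Main

end QCG

theorem mainTheorem2 {H K : Type*}
    [NormedAddCommGroup H] [InnerProductSpace ℂ H] [FiniteDimensional ℂ H] [CompleteSpace H]
    [NormedAddCommGroup K] [InnerProductSpace ℂ K] [FiniteDimensional ℂ K] [CompleteSpace K]
    (T : (H →L[ℂ] H) →ₗ[ℂ] (K →L[ℂ] K))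
    (hT_tr : QCG.IsTracePreserving T) (hT_pos : QCG.IsTwoPositive T)
    (D : Fin 2 → (H →L[ℂ] H)) (hD : ∀ s, QCG.IsDensity (D s))
    (hD_inv : ∀ s, IsUnit (D s)) (hTD_inv : ∀ s, IsUnit (T (D s)))
    (hsuff : QCG.IsSufficient T D) :
    ∃ (DK : StarSubalgebra ℂ (K →L[ℂ] K)) (DH : StarSubalgebra ℂ (H →L[ℂ] H)),
      -- the fixed-point algebras of `α ∘ T*` and `T* ∘ α`
      (∀ X, X ∈ DK ↔ QCG.alpha T (D 0) (QCG.hsAdjoint T X) = X) ∧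
      (∀ A, A ∈ DH ↔ QCG.hsAdjoint T (QCG.alpha T (D 0) A) = A) ∧
      (∀ X, ∀ Y ∈ DK, QCG.hsAdjoint T (X * Y) = QCG.hsAdjoint T X * QCG.hsAdjoint T Y) ∧
      ∃ (r : ℕ) (z : Fin r → (K →L[ℂ] K)) (lam : Fin 2 → Fin r → ℝ)
        (S : Fin 2 → Fin r → (K →L[ℂ] K)) (R : Fin r → (K →L[ℂ] K))
        (q : Fin r → (H →L[ℂ] H)) (SH : Fin 2 → Fin r → (H →L[ℂ] H))
        (RH : Fin r → (H →L[ℂ] H)),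
        -- the decomposition of `T (D s)` on `K`
        Function.Injective z ∧
        Set.range z = {e | QCG.IsMinimalCentralProjection (DK : Set (K →L[ℂ] K)) e} ∧
        (∀ s p, 0 ≤ lam s p) ∧ (∀ s, ∑ p, lam s p = 1) ∧
        (∀ s p, QCG.IsDensityIn (QCG.corner (z p) (DK : Set (K →L[ℂ] K))) (S s p)) ∧
        (∀ p, QCG.IsDensityIn
          (QCG.corner (z p) (Set.centralizer (DK : Set (K →L[ℂ] K)))) (R p)) ∧
        (∀ s, T (D s) = ∑ p, (lam s p : ℂ) • (S s p * R p)) ∧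
        -- the decomposition of `D s` on `H`
        (∀ p, q p = QCG.hsAdjoint T (z p)) ∧
        Function.Injective q ∧
        Set.range q = {e | QCG.IsMinimalCentralProjection (DH : Set (H →L[ℂ] H)) e} ∧
        (∀ p p', p ≠ p' → q p * q p' = 0) ∧
        (∀ s p, QCG.alpha T (D 0) (SH s p) = S s p) ∧
        (∀ p, RH p = QCG.sharp T (D 0) (R p)) ∧
        (∀ s p, QCG.IsDensityIn (QCG.corner (q p) (DH : Set (H →L[ℂ] H))) (SH s p)) ∧
        (∀ p, QCG.IsDensityIn
          (QCG.corner (q p) (Set.centralizer (DH : Set (H →L[ℂ] H)))) (RH p)) ∧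
        (∀ s p, SH s p * RH p = RH p * SH s p) ∧
        (∀ s, D s = ∑ p, (lam s p : ℂ) • (SH s p * RH p)) := by
  open QCG in
  have hDpos : ∀ s, IsStrictlyPositive (D s) := fun s =>
    IsStrictlyPositive.iff_of_unital.2 ⟨(hD s).1, hD_inv s⟩
  have hTDpos : ∀ s, IsStrictlyPositive (T (D s)) := fun s =>
    IsStrictlyPositive.iff_of_unital.2 ⟨hT_pos.map_nonneg (hD s).1, hTD_inv s⟩
  have h := isStatePair_alpha hT_pos hT_tr (hDpos 0) (hTDpos 0)
  obtain ⟨σ, R, R', hσF, hσ, hR, hR', hρ, hDs, hc, hc', hsharp⟩ :=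
    exists_common_factorization hT_pos hT_tr hDpos hTDpos hsuff h
  obtain ⟨r, z, hzinj, hzrange, hzsum⟩ := exists_enum_isMinimalCentralProjection h.fixedPoints
  have hz : ∀ p, IsMinimalCentralProjection (h.fixedPoints : Set (K →L[ℂ] K)) (z p) := by
    intro p
    have : z p ∈ Set.range z := ⟨p, rfl⟩
    rwa [hzrange] at this
  set A := hsAdjoint T with hA
  have hzF : ∀ p, z p ∈ h.fixedPoints := fun p => (hz p).1.1
  have hzc : ∀ p, ∀ x ∈ h.fixedPoints, Commute (z p) x := fun p x hx => ((hz p).1.2 x hx).symm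
  have hq : ∀ p, IsMinimalCentralProjection (h.symm.fixedPoints : Set (H →L[ℂ] H)) (A (z p)) :=
    fun p => h.map_isMinimalCentralProjection (hz p)
  have hqc : ∀ p, ∀ x ∈ h.symm.fixedPoints, Commute (A (z p)) x :=
    fun p x hx => ((hq p).1.2 x hx).symm
  have hRc : R ∈ Set.centralizer (h.fixedPoints : Set (K →L[ℂ] K)) :=
    fun x hx => (hc x hx).eq.symm
  have hR'c : R' ∈ Set.centralizer (h.symm.fixedPoints : Set (H →L[ℂ] H)) := by
    intro x hx
    have := hc' _ (h.symm.map_mem hx)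
    rw [h.symm.mem_fixedPoints.1 hx] at this
    exact this.eq.symm
  have hzp : ∀ p, IsStarProjection (z p) := fun p => (hz p).2.1
  have hqp : ∀ p, IsStarProjection (A (z p)) := fun p => (hq p).2.1
  choose e he using fun p => exists_isMinimalProjectionIn_corner
    (G := h.fixedPoints) (hzp p) (hz p).2.2.1
  choose e' he' using fun p => exists_isMinimalProjectionIn_corner
    (G := StarSubalgebra.centralizer ℂ (h.fixedPoints : Set (K →L[ℂ] K))) (hzp p) (hz p).2.2.1
  simp only [coe_centralizer_starSubalgebra] at he'
  have hee' : ∀ p, tr (e p) * tr (e' p) = tr (z p) := fun p => (hz p).tr_mul_tr (he p) (he' p)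
  have htz : ∀ p, tr (z p) ≠ 0 := fun p =>
    tr_ne_zero_of_isStarProjection (hzp p) (hz p).2.2.1
  have hte : ∀ p, tr (e p) ≠ 0 := fun p h0 => htz p (by rw [← hee', h0, zero_mul])
  have hte' : ∀ p, tr (e' p) ≠ 0 := fun p h0 => htz p (by rw [← hee', h0, mul_zero])
  have hAe : ∀ p, IsMinimalProjectionIn
      (corner (A (z p)) (h.symm.fixedPoints : Set (H →L[ℂ] H))) (A (e p)) :=
    fun p => h.map_isMinimalProjectionIn_corner (hzF p) (he p)
  have hze : ∀ p, e p ∈ h.fixedPoints ∧ z p * e p = e p := fun p =>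
    ⟨((he p).of_corner (hzF p) (hzp p)).1.1, ((he p).of_corner (hzF p) (hzp p)).2⟩
  -- `A` multiplies the trace on each summand by a constant, so it preserves normalizations.
  choose c hcA using fun p => h.exists_tr_map_eq (hz p)
  have hcz : ∀ p, tr (A (z p)) = c p * tr (z p) := fun p => by
    simpa using hcA p 1 (one_mem _)
  have hce : ∀ p, tr (A (e p)) = c p * tr (e p) := fun p => by
    simpa only [(hze p).2] using hcA p (e p) (hze p).1
  have hminK : ∀ p f, IsMinimalProjectionIn (corner (z p) (h.fixedPoints : Set (K →L[ℂ] K))) f →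
      tr f = tr (e p) := fun p f hf =>
    mul_right_cancel₀ (hte' p) (((hz p).tr_mul_tr hf (he' p)).trans (hee' p).symm)
  have hminK' : ∀ p f, IsMinimalProjectionIn (corner (z p)
      (Set.centralizer (h.fixedPoints : Set (K →L[ℂ] K)))) f → tr f = tr (e' p) := fun p f hf =>
    mul_left_cancel₀ (hte p) (((hz p).tr_mul_tr (he p) hf).trans (hee' p).symm)
  have hminH' : ∀ p f, IsMinimalProjectionIn (corner (A (z p))
      (Set.centralizer (h.symm.fixedPoints : Set (H →L[ℂ] H)))) f → tr f = tr (e' p) := by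
    intro p f hf
    refine mul_left_cancel₀ (tr_ne_zero_of_isStarProjection (hAe p).2.1 (hAe p).2.2.1) ?_
    rw [(hq p).tr_mul_tr (hAe p) hf, hcz, hce, mul_assoc, hee']
  have hminH : ∀ p f, IsMinimalProjectionIn
      (corner (A (z p)) (h.symm.fixedPoints : Set (H →L[ℂ] H))) f → tr f = tr (A (e p)) := by
    intro p f hf
    obtain ⟨g, hg⟩ := exists_isMinimalProjectionIn_corner
      (G := StarSubalgebra.centralizer ℂ (h.symm.fixedPoints : Set (H →L[ℂ] H))) (hqp p)
      (hq p).2.2.1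
    rw [coe_centralizer_starSubalgebra] at hg
    refine mul_right_cancel₀ (hte' p) ?_
    rw [← hminH' p g hg, (hq p).tr_mul_tr hf hg, (hq p).tr_mul_tr (hAe p) hg]
  have hσz : ∀ s p, tr (z p * σ s) ≠ 0 := fun s p =>
    tr_mul_ne_zero (hσ s) (hzp p) (hz p).2.2.1
  have hRz : ∀ p, tr (z p * R) ≠ 0 := fun p => tr_mul_ne_zero hR (hzp p) (hz p).2.2.1
  set a : Fin 2 → Fin r → ℂ := fun s p => tr (e p) / tr (z p * σ s) with ha
  set b : Fin r → ℂ := fun p => tr (e' p) / tr (z p * R) with hb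
  have hzσ0 : ∀ s p, 0 ≤ z p * σ s := fun s p =>
    Commute.mul_nonneg (hzp p).nonneg (hσ s).nonneg (hzc p _ (hσF s))
  have hzR0 : ∀ p, 0 ≤ z p * R := fun p =>
    Commute.mul_nonneg (hzp p).nonneg hR.nonneg (hc _ (hzF p)).symm
  have ha0 : ∀ s p, 0 ≤ a s p := fun s p =>
    complex_div_nonneg (tr_nonneg (he p).2.1.nonneg) (tr_nonneg (hzσ0 s p))
  have hb0 : ∀ p, 0 ≤ b p := fun p =>
    complex_div_nonneg (tr_nonneg (he' p).2.1.nonneg) (tr_nonneg (hzR0 p))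
  have hatr : ∀ s p, a s p * tr (z p * σ s) = tr (e p) := fun s p => div_mul_cancel₀ _ (hσz s p)
  have hbtr : ∀ p, b p * tr (z p * R) = tr (e' p) := fun p => div_mul_cancel₀ _ (hRz p)
  have hlam0 : ∀ s p, 0 ≤ tr (T (D s) * z p) := fun s p =>
    tr_mul_nonneg (hTDpos s).nonneg (hzp p).nonneg
  have hlamC : ∀ s p, (((tr (T (D s) * z p)).re : ℝ) : ℂ) = tr (T (D s) * z p) := fun s p =>
    (Complex.eq_re_of_ofReal_le (hlam0 s p)).symm
  -- The normalizing constants cancel because the trace is multiplicative on `z F · z F'`.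
  have hcoef : ∀ s p, tr (T (D s) * z p) * (a s p * b p) = 1 := by
    intro s p
    have h1 := (hz p).tr_mul_mul_tr (hσF s) hRc
    have h2 : tr (T (D s) * z p) = tr (z p * σ s * R) := by
      rw [tr_mul_comm, hρ, mul_assoc]
    rw [← h2, ← hee'] at h1
    simp only [ha, hb]
    have := hσz s p
    have := hRz p
    field_simp
    rw [← h1]
    ring
  have hqsum : ∑ p, A (z p) = 1 := by rw [← map_sum, hzsum, h.left.map_one]
  have hRHeq : ∀ p, sharp T (D 0) (b p • (z p * R)) = b p • (A (z p) * R') := fun p => by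
    rw [map_smul, sharp_mul h (hzF p), ← hsharp]
  have hRHtr : ∀ p, b p * tr (A (z p) * R') = tr (e' p) := fun p => by
    rw [← tr_smul, ← hRHeq, tr_sharp h, tr_smul, hbtr]
  have hSHeq : ∀ s p, A (a s p • (z p * σ s)) = a s p • (A (z p) * A (σ s)) := fun s p => by
    rw [map_smul, h.map_mul_left (hzF p)]
  refine ⟨h.fixedPoints, h.symm.fixedPoints, fun X => Iff.rfl, fun X => Iff.rfl,
    fun X Y hY => h.map_mul_right hY X, r, z, fun s p => (tr (T (D s) * z p)).re,
    fun s p => a s p • (z p * σ s), fun p => b p • (z p * R), fun p => A (z p),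
    fun s p => A (a s p • (z p * σ s)), fun p => sharp T (D 0) (b p • (z p * R)),
    hzinj, hzrange, fun s p => (Complex.nonneg_iff.1 (hlam0 s p)).1, ?_, ?_, ?_, ?_,
    fun _ => rfl, ?_, ?_, ?_, ?_, fun _ => rfl, ?_, ?_, ?_, ?_⟩
  · intro s
    rw [← Complex.re_sum, ← tr_sum, ← Finset.mul_sum, hzsum, mul_one, hT_tr, (hD s).2,
      Complex.one_re]
  · exact fun s p => isDensityIn_corner (hzp p) (hσF s) (hσ s).nonneg (hzc p _ (hσF s)) (ha0 s p)
      (hatr s p) (hminK p)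
  · intro p
    have := isDensityIn_corner (G := StarSubalgebra.centralizer ℂ (h.fixedPoints : Set _)) (a := R)
      (hzp p) (by rwa [← SetLike.mem_coe, coe_centralizer_starSubalgebra]) hR.nonneg
      (hc _ (hzF p)).symm (hb0 p) (hbtr p)
      (by rw [coe_centralizer_starSubalgebra]; exact hminK' p)
    rwa [coe_centralizer_starSubalgebra] at this
  · intro s
    have h1 : ∀ p, (((tr (T (D s) * z p)).re : ℝ) : ℂ) • (a s p • (z p * σ s) * b p • (z p * R)) =
        z p * T (D s) := by
      intro p
      rw [hlamC, smul_mul_smul_comm, smul_smul, hcoef, one_smul, (hzc p _ (hσF s)).eq, mul_assoc,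
        ← mul_assoc (z p), (hzp p).isIdempotentElem.eq, ← mul_assoc, ← (hzc p _ (hσF s)).eq,
        mul_assoc, ← hρ]
    rw [Finset.sum_congr rfl fun p _ => h1 p, ← Finset.sum_mul, hzsum, one_mul]
  · intro p p' hpp
    apply hzinj
    rw [← h.mem_fixedPoints.1 (hzF p), ← h.mem_fixedPoints.1 (hzF p')]
    exact congrArg _ hpp
  · ext f
    constructor
    · rintro ⟨p, rfl⟩
      exact hq p
    · intro hf
      have h1 := h.symm.map_isMinimalCentralProjection hf
      obtain ⟨p, hp⟩ : alpha T (D 0) f ∈ Set.range z := by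
        rw [hzrange]
        exact h1
      refine ⟨p, ?_⟩
      show A (z p) = f
      rw [hp]
      exact h.symm.mem_fixedPoints.1 hf.1.1
  · intro p p' hpp
    rw [← h.map_mul_left (hzF p), (hz p).mul_eq_zero (hz p') (fun h0 => hpp (hzinj h0)), map_zero]
  · exact fun s p => h.mem_fixedPoints.1
      (h.fixedPoints.smul_mem (mul_mem (hzF p) (hσF s)) (a s p))
  · intro s p
    simp only [hSHeq]
    refine isDensityIn_corner (hqp p) (h.map_mem (hσF s)) (h.left.map_nonneg (hσ s).nonneg)
      (hqc p _ (h.map_mem (hσF s))) (ha0 s p) ?_ (hminH p)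
    rw [← h.map_mul_left (hzF p), hcA p _ (hσF s), hce, ← hatr s p]
    ring
  · intro p
    simp only [hRHeq]
    have := isDensityIn_corner (G := StarSubalgebra.centralizer ℂ (h.symm.fixedPoints : Set _))
      (a := R') (hqp p) (by rwa [← SetLike.mem_coe, coe_centralizer_starSubalgebra]) hR'.nonneg
      (hc' _ (hzF p)).symm (hb0 p) (hRHtr p)
      (by rw [coe_centralizer_starSubalgebra]; exact hminH' p)
    rwa [coe_centralizer_starSubalgebra] at this
  · intro s p
    simp only [hRHeq]
    have hmem : A (a s p • (z p * σ s)) ∈ h.symm.fixedPoints :=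
      h.map_mem (h.fixedPoints.smul_mem (mul_mem (hzF p) (hσF s)) (a s p))
    have h1 : Commute (A (a s p • (z p * σ s))) (A (z p) * R') :=
      (hqc p _ hmem).symm.mul_right (hR'c _ hmem)
    exact (h1.smul_right (b p)).eq
  · intro s
    have h1 : ∀ p, (((tr (T (D s) * z p)).re : ℝ) : ℂ) •
        (A (a s p • (z p * σ s)) * sharp T (D 0) (b p • (z p * R))) = A (z p) * D s := by
      intro p
      have hcomm := hqc p _ (h.map_mem (hσF s))
      rw [hlamC, hSHeq, hRHeq, smul_mul_smul_comm, smul_smul, hcoef, one_smul, hcomm.eq, mul_assoc,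
        ← mul_assoc (A (z p)), (hqp p).isIdempotentElem.eq, ← mul_assoc, ← hcomm.eq, mul_assoc,
        ← hDs]
    rw [Finset.sum_congr rfl fun p _ => h1 p, ← Finset.sum_mul, hqsum, one_mul]
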